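/- **Theorem 1.** Graphs are finite and may have loops and parallel edges. A graph $H'$ is a *subdivision* of a simple graph $H$ if it is obtained from $H$ by subdividing edges, and it is an *almost $(\le 1)$-subdivision* of $H$ if moreover at most one edge of $H$ is subdivided more than once; a graph contains an (almost $(\le 1)$-)subdivision of $H$ if it has a subgraph isomorphic to one. A *coloring* of a graph $G$ is an arbitrary function on $V(G)$; its *monochromatic components* are the connected components of the subgraphs of $G$ induced by the color classes; it has *clustering* $\eta$ if each monochromatic component has at most $\eta$ vertices. A graph $G$ is *$s$-choosable with clustering $\eta$* if, for every assignment of a non-empty set $L(v)\subseteq\mathbb{Z}$ with $|L(v)|\ge s$ to each vertex $v$ of $G$, there is a coloring $c$ of $G$ with clustering $\eta$ such that $c(v)\in L(v)$ for every vertex $v$. (1) For all integers $s\ge 1$ and $w\ge 0$ there is $\eta\in\mathbb{N}$ such that every graph of treewidth at most $w$ that contains no almost $(\le 1)$-subdivision of $K_{s+1}$ is $s$-choosable with clustering $\eta$. (2) The number $s$ of colors is best possible, even for ordinary colorings: for all integers $s\ge 1$ and $\eta\ge 0$ there is a graph $G$ of treewidth at most $s-1$ that contains no subdivision of $K_{s+1}$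 (in particular, no almost $(\le 1)$-subdivision of $K_{s+1}$), such that every coloring of $G$ with $s-1$ colors has a monochromatic component with at least $\eta$ vertices. -/

import Mathlib

open scoped Graph

universe u v

namespace Graph

variable {α : Type u} {β : Type v}

/-- A tree-decomposition of a (multi)graph `G`, indexed by the nodes of a finite tree. -/
structure TreeDecomposition (G : Graph α β) where
  /-- the nodes of the tree -/
  node : Type
  finite_node : Finite node
  /-- the tree -/
  tree : SimpleGraph node
  isTree : tree.IsTree
  /-- the bags -/
  bag : node → Set V(G)
  /-- the nodes whose bags contain a given vertex induce a non-empty connected subtree -/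
  connected : ∀ x : V(G), (tree.induce {t | x ∈ bag t}).Connected
  /-- the ends of each edge lie in a common bag -/
  edge : ∀ x y : V(G), G.Adj x y → ∃ t, x ∈ bag t ∧ y ∈ bag t

/-- The width of a tree-decomposition: the maximum of `|bag| - 1`. (Truncated subtraction only
matters for the graph without vertices, which gets width `0`.) -/
noncomputable def TreeDecomposition.width {G : Graph α β} (D : G.TreeDecomposition) : ℕ∞ :=
  ⨆ t : D.node, ((D.bag t).encard - 1)

/-- The treewidth of `G`: the minimum width of a tree-decomposition of `G`. -/
noncomputable def treewidth (G : Graph α β) : ℕ∞ :=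
  ⨅ D : G.TreeDecomposition, D.width

/-- A subgraph of the (multi)graph `G` that is a subdivision of the simple graph `H`, given by the
vertices of `G` that represent the vertices of `H` and, for each edge of `H`, the path of `G`
into which that edge is subdivided. Paths of `G` are taken as sequences of vertices, that is, as
paths of the simple graph `G.toSimpleGraph` in which two distinct vertices are adjacent
if and only if they are adjacent in `G`. -/
structure SubdivisionIn {W : Type*} (H : SimpleGraph W) (G : Graph α β) where
  /-- the original vertices of `H` -/
  branch : W → V(G)
  branch_injective : Function.Injective branch
  /-- the path that replaces an edge of `H` -/
  path : ∀ a b : W, H.Adj a b → G.toSimpleGraph.Walk (branch a) (branch b)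
  isPath : ∀ (a b : W) (h : H.Adj a b), (path a b h).IsPath
  /-- the two orientations of an edge of `H` give the same path -/
  path_symm : ∀ (a b : W) (h : H.Adj a b), path b a h.symm = (path a b h).reverse
  /-- the inner vertices of the paths are new vertices -/
  branch_mem : ∀ (a b : W) (h : H.Adj a b) (c : W),
    branch c ∈ (path a b h).support → c = a ∨ c = b
  /-- paths that replace different edges of `H` share no vertices besides original vertices -/
  disjoint : ∀ (a b : W) (h : H.Adj a b) (a' b' : W) (h' : H.Adj a' b'), s(a, b) ≠ s(a', b') →
    ∀ x : V(G), x ∈ (path a b h).support → x ∈ (path a' b' h').support → ∃ c : W, x = branch c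

/-- How many times the edge `ab` of `H` is subdivided. -/
def SubdivisionIn.count {W : Type*} {H : SimpleGraph W} {G : Graph α β} (S : SubdivisionIn H G)
    (a b : W) (h : H.Adj a b) : ℕ :=
  (S.path a b h).length - 1

/-- The subdivision is an almost `(≤ 1)`-subdivision: at most one edge of `H` is subdivided more
than once. -/
def SubdivisionIn.IsAlmost {W : Type*} {H : SimpleGraph W} {G : Graph α β}
    (S : SubdivisionIn H G) : Prop :=
  ∀ (a b : W) (h : H.Adj a b) (a' b' : W) (h' : H.Adj a' b'),
    1 < S.count a b h → 1 < S.count a' b' h' → s(a, b) = s(a', b')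

/-- `G` contains a subdivision of `H` as a subgraph. -/
def ContainsSubdivision {W : Type*} (G : Graph α β) (H : SimpleGraph W) : Prop :=
  Nonempty (SubdivisionIn H G)

/-- `G` contains an almost `(≤ 1)`-subdivision of `H` as a subgraph. -/
def ContainsAlmostSubdivision {W : Type*} (G : Graph α β) (H : SimpleGraph W) : Prop :=
  ∃ S : SubdivisionIn H G, S.IsAlmost

/-- A monochromatic component of a colouring `c` of `G`: a connected component of the subgraph
induced by the vertices of colour `i`, for some colour `i`. -/
abbrev MonochromaticComponent {C : Type*} (G : Graph α β) (c : V(G) → C) : Type _ :=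
  Σ i : C, (G.toSimpleGraph.induce {x | c x = i}).ConnectedComponent

/-- The number of vertices of a monochromatic component. -/
noncomputable def MonochromaticComponent.size {C : Type*} {G : Graph α β} {c : V(G) → C}
    (K : G.MonochromaticComponent c) : ℕ∞ :=
  K.2.supp.encard

/-- The colouring `c` of `G` has clustering `η`. -/
def HasClustering {C : Type*} (G : Graph α β) (c : V(G) → C) (η : ℕ) : Prop :=
  ∀ K : G.MonochromaticComponent c, K.size ≤ η

/-- `G` is `l`-choosable with clustering `η`. -/
def ChoosableWithClustering (G : Graph α β) (l η : ℕ) : Prop :=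
  ∀ L : V(G) → Set ℤ, (∀ x, (L x).Nonempty) → (∀ x, (l : ℕ∞) ≤ (L x).encard) →
    ∃ c : V(G) → ℤ, (∀ x, c x ∈ L x) ∧ G.HasClustering c η

end Graph

/-!
Both parts rest on the sets of `p = s - 1` vertices that have many common neighbours.

**Upper bound.** If `p` vertices have at least `p * p + 2` common neighbours and two of the common
neighbours are joined by a path avoiding the `p` vertices, then a shortest such path is the long
path of an almost `(≤ 1)`-subdivision of `K_{p+2}`: its ends and the `p` vertices are the branch
vertices, and further common neighbours subdivide the edges between the `p` vertices
(`Graph.containsAlmostSubdivision_of_common`). So a set of `p` vertices with many common neighbours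
separates them from each other (`SimpleGraph.SeparatesCommonNb`), and a connected set contains only
boundedly many vertices with at least `p` neighbours in its boundary, provided that this boundary is
small.

The colouring is extended from the boundary of a connected set `K` to `K` in rounds
(`SimpleGraph.exists_extension`). A vertex with fewer than `p` coloured neighbours loses their
colours from its list and keeps at least two colours, so it never joins a component that is already
there. The boundedly many vertices of `K` with at least `p` coloured neighbours still have two
colours, so they can avoid any one colour `c₀`: if they are coloured in this round, no
monochromatic component of colour `c₀` leaves the boundary of `K`. After as many rounds as there are
colours on the boundary all its monochromatic components have been stopped, and new ones start. In
each round a bounded set of further vertices is coloured, such that all remaining components have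
boundary of size at most `2 * (w + 1)`; for this, one takes the bags of a set of nodes of the
tree-decomposition that is closed under meets in the tree order
(`SimpleGraph.RootedDecomposition.exists_closure`). A monochromatic component may thus spread into
many uncoloured components, but only into those that contain a vertex with at least `p` coloured
neighbours. If the boundary of such a component is a set of `p` vertices with many common
neighbours, then the vertex has exactly `p` coloured neighbours and can avoid all their colours. The
number of the others is bounded (`SimpleGraph.card_leaks_le`).

**Lower bound.** In the closure of the complete `η`-ary tree with `s` levels, two nodes that are not
on a common branch are separated by fewer than `s` common ancestors, whereas `s` disjoint paths join
two branch vertices of a subdivision of `K_{s+1}`. Hence the `s + 1` branch vertices would lie on one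
branch, which has only `s` nodes. If `s - 1` colours are used, then on some branch one meets a node
whose colour appears below each of its `η` children.
-/

/-! ### The tree order of a rooted tree -/

namespace SimpleGraph

lemma exists_walk_of_induce {V : Type*} {G : SimpleGraph V} {S : Set V} {x y : S}
    (w : (G.induce S).Walk x y) : ∃ q : G.Walk x y, ∀ z ∈ q.support, z ∈ S := by
  induction w with
  | nil => exact ⟨.nil, by simp⟩
  | @cons a b c h w ih =>
    obtain ⟨q, hq⟩ := ih
    have h' : G.Adj (a : V) (b : V) := h
    refine ⟨.cons h' q, fun z hz => ?_⟩
    rw [Walk.support_cons, List.mem_cons] at hz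
    rcases hz with rfl | hz
    · exact a.2
    · exact hq z hz

namespace IsTree

variable {N : Type*} {T : SimpleGraph N}

/-- The tree order of a tree with root `r`: `x` lies below `y` if `x` is on the path from `r`
to `y`. The order is a meet-semilattice because the elements below a given node form a chain. -/
def RootLE (T : SimpleGraph N) (r x y : N) : Prop :=
  ∃ q : T.Walk r y, q.IsPath ∧ x ∈ q.support

lemma RootLE.mem_support (hT : T.IsTree) {r x y : N} (h : RootLE T r x y) {q : T.Walk r y}
    (hq : q.IsPath) : x ∈ q.support := by
  obtain ⟨q', hq', hx⟩ := h
  rwa [(hT.existsUnique_path r y).unique hq hq']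

lemma rootLE_refl (hT : T.IsTree) (r x : N) : RootLE T r x x := by
  obtain ⟨q, hq, -⟩ := hT.existsUnique_path r x
  exact ⟨q, hq, q.end_mem_support⟩

lemma rootLE_root (hT : T.IsTree) (r x : N) : RootLE T r r x := by
  obtain ⟨q, hq, -⟩ := hT.existsUnique_path r x
  exact ⟨q, hq, q.start_mem_support⟩

lemma RootLE.trans (hT : T.IsTree) {r x y z : N} (h : RootLE T r x y) (h' : RootLE T r y z) :
    RootLE T r x z := by
  classical
  obtain ⟨q, hq, hy⟩ := h'
  exact ⟨q, hq, q.support_takeUntil_subset_support hy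
    (h.mem_support hT (hq.takeUntil hy))⟩

lemma RootLE.antisymm (hT : T.IsTree) {r x y : N} (h : RootLE T r x y) (h' : RootLE T r y x) :
    x = y := by
  classical
  by_contra hne
  obtain ⟨q, hq, hx⟩ := h
  have h1 := h'.mem_support hT (hq.takeUntil hx)
  have h2 := (q.takeUntil x hx).length_takeUntil_lt_length h1 (Ne.symm hne)
  have h3 := (hT.existsUnique_path r y).unique ((hq.takeUntil hx).takeUntil h1) hq
  have h4 := q.length_takeUntil_lt_length hx hne
  rw [h3] at h2
  omega

lemma RootLE.chain (hT : T.IsTree) {r x y z : N} (h : RootLE T r x z) (h' : RootLE T r y z) :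
    RootLE T r x y ∨ RootLE T r y x := by
  classical
  obtain ⟨q, hq, hy⟩ := h'
  have hx := h.mem_support hT hq
  rw [← q.take_spec hy, SimpleGraph.Walk.mem_support_append_iff] at hx
  rcases hx with hx | hx
  · exact Or.inl ⟨_, hq.takeUntil hy, hx⟩
  · refine Or.inr ⟨(q.takeUntil y hy).append ((q.dropUntil y hy).takeUntil x hx), ?_, ?_⟩
    · apply SimpleGraph.Walk.IsPath.of_append_left (q := (q.dropUntil y hy).dropUntil x hx)
      rw [← SimpleGraph.Walk.append_assoc, SimpleGraph.Walk.take_spec,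
        SimpleGraph.Walk.take_spec]
      exact hq
    · rw [SimpleGraph.Walk.mem_support_append_iff]
      exact Or.inl (SimpleGraph.Walk.end_mem_support _)

/-- A connected set of nodes of a rooted tree has a least element in the tree order, and contains
everything between that element and its other elements. -/
lemma exists_least_of_connected (hT : T.IsTree) (r : N) {S : Set N}
    (hS : (T.induce S).Connected) :
    ∃ t ∈ S, ∀ b ∈ S, RootLE T r t b ∧ ∀ t', RootLE T r t t' → RootLE T r t' b → t' ∈ S := by
  classical
  choose path hpath hu using hT.existsUnique_path r
  have hne : S.Nonempty := Set.nonempty_coe_sort.1 hS.nonempty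
  obtain ⟨t, htS, hmin⟩ : ∃ t ∈ S, ∀ b ∈ S, (path t).length ≤ (path b).length :=
    ⟨Function.argminOn (fun b => (path b).length) S hne, Function.argminOn_mem _ _ _,
      fun b hb => Function.argminOn_le (fun b => (path b).length) S hb⟩
  refine ⟨t, htS, fun b hb => ?_⟩
  obtain ⟨w⟩ := hS.preconnected ⟨t, htS⟩ ⟨b, hb⟩
  obtain ⟨q, hq, hqS⟩ : ∃ q : T.Walk t b, q.IsPath ∧ ∀ x ∈ q.support, x ∈ S := by
    obtain ⟨q, hq⟩ := exists_walk_of_induce w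
    exact ⟨q.bypass, q.bypass_isPath, fun x hx => hq x (q.support_bypass_subset_support hx)⟩
  -- by minimality of `t`, the path from `r` to `t` meets `S` in `t` only
  have hdisj : ∀ x ∈ (path t).support, x ∈ S → x = t := by
    intro x hx hxS
    by_contra hxt
    have h1 := (path t).length_takeUntil_lt_length hx hxt
    have h2 := hmin x hxS
    rw [← hu x _ ((hpath t).takeUntil hx)] at h2
    exact absurd h1 (not_lt.2 h2)
  have happ : ((path t).append q).IsPath := by
    rw [SimpleGraph.Walk.isPath_def, SimpleGraph.Walk.support_append,
      List.nodup_append']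
    have hqn := hq.support_nodup
    rw [← SimpleGraph.Walk.cons_tail_support] at hqn
    refine ⟨(hpath t).support_nodup, (List.nodup_cons.1 hqn).2, fun x hx hx' => ?_⟩
    have := hdisj x hx (hqS x (List.mem_of_mem_tail hx'))
    subst this
    exact (List.nodup_cons.1 hqn).1 hx'
  refine ⟨⟨_, happ, ?_⟩, fun t' h1 h2 => ?_⟩
  · rw [SimpleGraph.Walk.mem_support_append_iff]
    exact Or.inl (SimpleGraph.Walk.end_mem_support _)
  · have := h2.mem_support hT happ
    rw [SimpleGraph.Walk.mem_support_append_iff] at this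
    rcases this with h | h
    · rw [RootLE.antisymm hT ⟨_, hpath t, h⟩ h1]
      exact htS
    · exact hqS _ h

lemma exists_semilatticeInf [Finite N] (hT : T.IsTree) (r : N) :
    ∃ I : SemilatticeInf N, ∀ x y, I.le x y ↔ RootLE T r x y := by
  classical
  have hinf : ∀ x y : N, ∃ m, RootLE T r m x ∧ RootLE T r m y ∧
      ∀ z, RootLE T r z x → RootLE T r z y → RootLE T r z m := by
    intro x y
    choose path hpath hu using hT.existsUnique_path r
    let S : Set N := {z | RootLE T r z x ∧ RootLE T r z y}
    obtain ⟨m, hm, hmax⟩ := (Set.toFinite S).exists_maximalFor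
      (fun z => (path z).length) S ⟨r, rootLE_root hT r x, rootLE_root hT r y⟩
    refine ⟨m, hm.1, hm.2, fun z hz hz' => ?_⟩
    rcases RootLE.chain hT hz hm.1 with h | h
    · exact h
    · have h1 := h.mem_support hT (hpath z)
      by_cases hzm : z = m
      · subst hzm; exact h
      · have h2 := (path z).length_takeUntil_lt_length h1 (Ne.symm hzm)
        rw [hu m _ ((hpath z).takeUntil h1)] at h2
        have h3 := hmax (j := z) ⟨hz, hz'⟩ h2.le
        exact absurd h2 (not_lt.2 h3)
  choose m hm1 hm2 hm3 using hinf
  exact ⟨{ le := RootLE T r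
           le_refl := rootLE_refl hT r
           le_trans := fun _ _ _ h h' => h.trans hT h'
           le_antisymm := fun _ _ h h' => h.antisymm hT h'
           inf := m
           inf_le_left := hm1
           inf_le_right := hm2
           le_inf := fun x y z h h' => hm3 y z x h h' }, fun _ _ => Iff.rfl⟩

end IsTree

end SimpleGraph

/-! ### Connectivity inside vertex sets -/

namespace SimpleGraph

variable {V : Type*} (Γ : SimpleGraph V)

/-- `Γ.ReachIn S x y`: the vertices `x` and `y` are equal or are joined by a walk of `Γ` all of
whose vertices lie in `S`. -/
def ReachIn (S : Set V) : V → V → Prop :=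
  Relation.ReflTransGen fun a b => Γ.Adj a b ∧ a ∈ S ∧ b ∈ S

open scoped Classical in
/-- The vertices outside `K` that have a neighbour in `K`. -/
noncomputable def bdry [Fintype V] (K : Finset V) : Finset V :=
  Finset.univ.filter fun y => y ∉ K ∧ ∃ x ∈ K, Γ.Adj x y

variable {Γ}

lemma mem_bdry [Fintype V] {K : Finset V} {y : V} :
    y ∈ Γ.bdry K ↔ y ∉ K ∧ ∃ x ∈ K, Γ.Adj x y := by
  simp [bdry]

lemma ReachIn.symm {S : Set V} {x y : V} (h : Γ.ReachIn S x y) : Γ.ReachIn S y x := by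
  induction h with
  | refl => exact .refl
  | tail _ h ih => exact .head ⟨h.1.symm, h.2.2, h.2.1⟩ ih

lemma ReachIn.mem {S : Set V} {x y : V} (h : Γ.ReachIn S x y) (hx : x ∈ S) : y ∈ S := by
  induction h with
  | refl => exact hx
  | tail _ h _ => exact h.2.2

lemma ReachIn.mono {S S' : Set V} (hS : S ⊆ S') {x y : V} (h : Γ.ReachIn S x y) :
    Γ.ReachIn S' x y := by
  induction h with
  | refl => exact .refl
  | tail _ h ih => exact ih.tail ⟨h.1, hS h.2.1, hS h.2.2⟩

/-! ### Rooted tree-decompositions -/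

/-- A tree-decomposition over a rooted tree, given by its tree order `N` (a meet-semilattice in
which the elements below a given one form a chain): the nodes whose bags contain the vertex `x`
have the least element `top x`, and contain with `t` everything between `top x` and `t`. -/
structure RootedDecomposition (Γ : SimpleGraph V) (N : Type*) [SemilatticeInf N] where
  chain : ∀ {a b c : N}, a ≤ c → b ≤ c → a ≤ b ∨ b ≤ a
  bag : N → Finset V
  top : V → N
  mem_top : ∀ x, x ∈ bag (top x)
  top_le : ∀ {x t}, x ∈ bag t → top x ≤ t
  convex : ∀ {x t t'}, x ∈ bag t → top x ≤ t' → t' ≤ t → x ∈ bag t'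
  adj : ∀ {x y}, Γ.Adj x y → ∃ t, x ∈ bag t ∧ y ∈ bag t

namespace RootedDecomposition

variable {N : Type*} [SemilatticeInf N]

/-- The nodes whose bags meet a connected set form a subtree. -/
lemma exists_top_of_connected (D : RootedDecomposition Γ N) {K : Finset V} (hne : K.Nonempty)
    (hK : ∀ x ∈ K, ∀ y ∈ K, Γ.ReachIn K x y) :
    ∃ t₀, (∃ x ∈ K, x ∈ D.bag t₀) ∧ ∀ x ∈ K, ∀ t, x ∈ D.bag t →
      t₀ ≤ t ∧ ∀ t', t₀ ≤ t' → t' ≤ t → ∃ y ∈ K, y ∈ D.bag t' := by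
  obtain ⟨x₀, hx₀, hmin⟩ := K.exists_minimalFor D.top hne
  refine ⟨D.top x₀, ⟨x₀, hx₀, D.mem_top x₀⟩, fun x hx => ?_⟩
  have key : ∀ z, Γ.ReachIn K x₀ z → ∀ t, z ∈ D.bag t →
      D.top x₀ ≤ t ∧ ∀ t', D.top x₀ ≤ t' → t' ≤ t → ∃ y ∈ K, y ∈ D.bag t' := by
    intro z hz
    induction hz with
    | refl => exact fun t ht => ⟨D.top_le ht, fun t' h1 h2 => ⟨x₀, hx₀, D.convex ht h1 h2⟩⟩
    | @tail y z _ hyz ih =>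
      obtain ⟨hadj, -, hzK⟩ := hyz
      obtain ⟨t, hyt, hzt⟩ := D.adj hadj
      have h0 : D.top x₀ ≤ D.top z := by
        rcases D.chain (ih t hyt).1 (D.top_le hzt) with h | h
        · exact h
        · exact hmin hzK h
      refine fun t₂ ht₂ => ⟨h0.trans (D.top_le ht₂), fun t' h1 h2 => ?_⟩
      rcases D.chain h2 (D.top_le ht₂) with h | h
      · exact (ih t hyt).2 t' h1 (h.trans (D.top_le hzt))
      · exact ⟨z, hzK, D.convex ht₂ h h2⟩
  exact key x (hK x₀ hx₀ x hx)

open scoped Classical in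
lemma inf_mem_image₂ (D : RootedDecomposition Γ N) (Q : Finset N) {x y : N}
    (hx : x ∈ Finset.image₂ (· ⊓ ·) Q Q) (hy : y ∈ Finset.image₂ (· ⊓ ·) Q Q) :
    x ⊓ y ∈ Finset.image₂ (· ⊓ ·) Q Q := by
  -- two of the three meets of pairs from `a`, `b`, `c` are comparable
  have triple : ∀ a ∈ Q, ∀ b ∈ Q, ∀ c ∈ Q, ∃ d ∈ Q, ∃ e ∈ Q, a ⊓ b ⊓ c = d ⊓ e := by
    intro a ha b hb c hc
    rcases D.chain (inf_le_left : a ⊓ b ≤ a) (inf_le_left : a ⊓ c ≤ a) with h | h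
    · exact ⟨a, ha, b, hb, inf_eq_left.2 (h.trans inf_le_right)⟩
    · refine ⟨a, ha, c, hc, le_antisymm ?_ ?_⟩
      · exact le_inf (inf_le_left.trans inf_le_left) inf_le_right
      · exact le_inf h inf_le_right
  simp only [Finset.mem_image₂] at hx hy ⊢
  obtain ⟨a, ha, b, hb, rfl⟩ := hx
  obtain ⟨c, hc, d, hd, rfl⟩ := hy
  obtain ⟨e, he, f, hf, h1⟩ := triple a ha b hb c hc
  obtain ⟨g, hg, i, hi, h2⟩ := triple e he f hf d hd
  exact ⟨g, hg, i, hi, by rw [← inf_assoc, h1, h2]⟩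

/-- In a graph of bounded treewidth every set `S` of vertices lies in a set `S'`, of size bounded
in terms of the size of `S`, such that each connected set that avoids `S'` attaches to at most
`2 * (w + 1)` of its vertices. The set `S'` is the union of the bags of a set of nodes that
is closed under meets: a connected set that avoids `S'` attaches to the bag of the last of these
nodes below it, and to the bag of at most one of those above it. -/
theorem exists_closure [OrderBot N] [Fintype V] (D : RootedDecomposition Γ N) {w : ℕ}
    (hw : ∀ t, (D.bag t).card ≤ w + 1) (S : Finset V) :
    ∃ S' : Finset V, S ⊆ S' ∧ S'.card ≤ (S.card + 1) * (S.card + 1) * (w + 1) ∧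
      ∀ K B : Finset V, K.Nonempty → (∀ x ∈ K, ∀ y ∈ K, Γ.ReachIn K x y) → Disjoint K S' →
        B ⊆ S' → B ⊆ Γ.bdry K → B.card ≤ 2 * (w + 1) := by
  classical
  let Q₀ : Finset N := insert ⊥ (S.image D.top)
  let Q : Finset N := Finset.image₂ (· ⊓ ·) Q₀ Q₀
  have hQ₀Q : ∀ q ∈ Q₀, q ∈ Q := fun q hq => Finset.mem_image₂.2 ⟨q, hq, q, hq, inf_idem q⟩
  have hQ₀ : Q₀.card ≤ S.card + 1 :=
    (Finset.card_insert_le _ _).trans (Nat.add_le_add_right Finset.card_image_le 1)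
  refine ⟨Q.biUnion D.bag, fun x hx => ?_, ?_, ?_⟩
  · exact Finset.mem_biUnion.2 ⟨D.top x, hQ₀Q _ (Finset.mem_insert_of_mem
      (Finset.mem_image_of_mem _ hx)), D.mem_top x⟩
  · refine (Finset.card_biUnion_le_card_mul _ _ (w + 1) fun t _ => hw t).trans ?_
    exact Nat.mul_le_mul_right _ ((Finset.card_image₂_le _ _ _).trans (Nat.mul_le_mul hQ₀ hQ₀))
  intro K B hne hK hdisj hBS hBK
  obtain ⟨t₀, -, ht₀⟩ := D.exists_top_of_connected hne hK
  have hKQ : ∀ y ∈ K, ∀ q ∈ Q, y ∉ D.bag q := fun y hy q hq h =>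
    Finset.disjoint_left.1 hdisj hy (Finset.mem_biUnion.2 ⟨q, hq, h⟩)
  obtain ⟨a, ha, hmax⟩ := (Q.filter (· ≤ t₀)).exists_maximal
    ⟨⊥, Finset.mem_filter.2 ⟨hQ₀Q _ (Finset.mem_insert_self _ _), bot_le⟩⟩
  rw [Finset.mem_filter] at ha
  have hmax' : ∀ l ∈ Q, l ≤ t₀ → a < l → False := fun l hl h1 h2 =>
    absurd (hmax (Finset.mem_filter.2 ⟨hl, h1⟩) h2.le) (not_le_of_gt h2)
  -- the first node of `Q` on the way up from `K` to the node `q`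
  let Above : N → Prop := fun q => q ∈ Q ∧ ∃ t m, m ≤ q ∧ m ≤ t ∧ a < m ∧ (∃ y ∈ K, y ∈ D.bag t) ∧
    ∀ q' ∈ Q, m ≤ q' → q' ≤ q → q' = q
  have habove : ∀ x ∈ B, x ∉ D.bag a → ∃ q, Above q ∧ x ∈ D.bag q := by
    intro x hx hxa
    obtain ⟨-, y, hy, hadj⟩ := mem_bdry.1 (hBK hx)
    obtain ⟨t, hyt, hxt⟩ := D.adj hadj
    obtain ⟨q₁, hq₁, hxq₁⟩ := Finset.mem_biUnion.1 (hBS hx)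
    have hm : D.top x ≤ q₁ ⊓ t := le_inf (D.top_le hxq₁) (D.top_le hxt)
    have hat : a ≤ t := ha.2.trans (ht₀ y hy t hyt).1
    have ham : a < q₁ ⊓ t := by
      rcases D.chain hat (inf_le_right : q₁ ⊓ t ≤ t) with h | h
      · refine lt_of_le_of_ne h fun h' => hxa ?_
        rw [h']
        exact D.convex hxt hm inf_le_right
      · exact absurd (D.convex hxt (hm.trans h) hat) hxa
    obtain ⟨q, hq, hqmin⟩ := (Q.filter fun q => q₁ ⊓ t ≤ q ∧ q ≤ q₁).exists_minimal
      ⟨q₁, Finset.mem_filter.2 ⟨hq₁, inf_le_left, le_rfl⟩⟩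
    rw [Finset.mem_filter] at hq
    refine ⟨q, ⟨hq.1, t, q₁ ⊓ t, hq.2.1, inf_le_right, ham, ⟨y, hy, hyt⟩, fun q' hq' h1 h2 => ?_⟩,
      D.convex hxq₁ (hm.trans hq.2.1) hq.2.2⟩
    exact le_antisymm h2 (hqmin (Finset.mem_filter.2 ⟨hq', h1, h2.trans hq.2.2⟩) h2)
  have hstep : ∀ q, Above q → ∃ n, a < n ∧ n ≤ t₀ ∧ n ≤ q := by
    rintro q ⟨hq, t, m, hmq, hmt, ham, ⟨y, hy, hyt⟩, -⟩
    have h1 := (ht₀ y hy t hyt).1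
    rcases D.chain hmt h1 with h | h
    · exact ⟨m, ham, h, hmq⟩
    · refine ⟨t₀, lt_of_le_of_ne ha.2 ?_, le_rfl, h.trans hmq⟩
      rintro rfl
      obtain ⟨z, hz, hz'⟩ := (ht₀ y hy t hyt).2 a le_rfl h1
      exact hKQ z hz a ha.1 hz'
  have hclimb : ∀ q l, Above q → l ∈ Q → a < l → l ≤ q → l = q := by
    rintro q l ⟨hq, t, m, hmq, hmt, ham, ⟨y, hy, hyt⟩, hfirst⟩ hl hal hlq
    rcases D.chain hlq hmq with h | h
    · have hlt := h.trans hmt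
      rcases D.chain hlt (ht₀ y hy t hyt).1 with h' | h'
      · exact (hmax' l hl h' hal).elim
      · obtain ⟨z, hz, hz'⟩ := (ht₀ y hy t hyt).2 l h' hlt
        exact (hKQ z hz l hl hz').elim
    · exact hfirst l hl h hlq
  have huniq : ∀ q₁ q₂, Above q₁ → Above q₂ → q₁ = q₂ := by
    intro q₁ q₂ h1 h2
    obtain ⟨n₁, hn₁, hn₁t, hn₁q⟩ := hstep q₁ h1
    obtain ⟨n₂, hn₂, hn₂t, hn₂q⟩ := hstep q₂ h2
    have hal : a < q₁ ⊓ q₂ := by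
      rcases D.chain hn₁t hn₂t with h | h
      · exact hn₁.trans_le (le_inf hn₁q (h.trans hn₂q))
      · exact hn₂.trans_le (le_inf (h.trans hn₁q) hn₂q)
    have hl : q₁ ⊓ q₂ ∈ Q := D.inf_mem_image₂ Q₀ h1.1 h2.1
    rw [← hclimb q₁ _ h1 hl hal inf_le_left, hclimb q₂ _ h2 hl hal inf_le_right]
  obtain ⟨b, hb⟩ : ∃ b, B ⊆ D.bag a ∪ D.bag b := by
    by_cases h : ∃ x ∈ B, x ∉ D.bag a
    · obtain ⟨x, hx, hxa⟩ := h
      obtain ⟨b, hb, -⟩ := habove x hx hxa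
      refine ⟨b, fun z hz => ?_⟩
      rw [Finset.mem_union]
      by_cases hza : z ∈ D.bag a
      · exact Or.inl hza
      · obtain ⟨q, hq, hzq⟩ := habove z hz hza
        rw [huniq q b hq hb] at hzq
        exact Or.inr hzq
    · push Not at h
      exact ⟨a, fun z hz => Finset.mem_union_left _ (h z hz)⟩
  refine (Finset.card_le_card hb).trans ((Finset.card_union_le _ _).trans ?_)
  have := hw a
  have := hw b
  omega

end RootedDecomposition

end SimpleGraph

namespace Graph

variable {α : Type u} {β : Type v}

/-- A tree-decomposition of small width, rooted at an arbitrary node. -/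
theorem exists_rootedDecomposition (G : Graph α β) [Fintype V(G)] {w : ℕ}
    (h : G.treewidth ≤ w) :
    ∃ (N : Type) (_ : SemilatticeInf N) (_ : OrderBot N)
      (D : SimpleGraph.RootedDecomposition G.toSimpleGraph N), ∀ t, (D.bag t).card ≤ w + 1 := by
  classical
  obtain ⟨D, hD⟩ : ∃ D : G.TreeDecomposition, D.width ≤ w := by
    have h1 : G.treewidth < (w + 1 : ℕ) := lt_of_le_of_lt h (by exact_mod_cast Nat.lt_succ_self w)
    obtain ⟨D, hD⟩ := iInf_lt_iff.1 h1
    exact ⟨D, by rwa [Nat.cast_add, Nat.cast_one, ENat.lt_add_one_iff (by simp)] at hD⟩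
  have := D.finite_node
  obtain ⟨r⟩ := D.isTree.connected.nonempty
  obtain ⟨I, hI⟩ := SimpleGraph.IsTree.exists_semilatticeInf D.isTree r
  choose top htop hmin using fun x => D.isTree.exists_least_of_connected r (D.connected x)
  refine ⟨D.node, I, { bot := r, bot_le := fun x => (hI r x).2 (D.isTree.rootLE_root r x) },
    { chain := fun {a b c} h h' => ?_
      bag := fun t => (D.bag t).toFinset
      top := top
      mem_top := fun x => by simpa using htop x
      top_le := fun {x t} h => (hI _ _).2 (hmin x t (by simpa using h)).1
      convex := fun {x t t'} h h1 h2 => by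
        have := (hmin x t (by simpa using h)).2 t' ((hI _ _).1 h1) ((hI _ _).1 h2)
        simpa using this
      adj := fun {x y} h => by
        obtain ⟨t, h1, h2⟩ := D.edge x y h.2
        exact ⟨t, by simpa using h1, by simpa using h2⟩ }, fun t => ?_⟩
  · rw [hI, hI]
    exact SimpleGraph.IsTree.RootLE.chain D.isTree ((hI _ _).1 h) ((hI _ _).1 h')
  · have h1 : (D.bag t).encard - 1 ≤ w := (le_iSup (fun t => (D.bag t).encard - 1) t).trans hD
    rw [tsub_le_iff_right] at h1
    have h2 : (((D.bag t).toFinset.card : ℕ) : ℕ∞) ≤ ((w + 1 : ℕ) : ℕ∞) := by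
      rw [← Set.encard_coe_eq_coe_finsetCard, Set.coe_toFinset]
      exact_mod_cast h1
    exact_mod_cast h2

end Graph

/-! ### Almost subdivisions from sets with many common neighbours -/

namespace Graph

variable {α : Type u} {β : Type v}

/-- A way to give an almost `(≤ 1)`-subdivision of a complete graph: it is enough to give one
path for each pair `a < b`, with inner vertices in prescribed sets that are pairwise disjoint and
contain no branch vertex, where only the path of one pair `a₀ b₀` may have length more than `2`. -/
lemma containsAlmostSubdivision_of_lt {G : Graph α β} {W : Type*} [LinearOrder W]
    (branch : W → V(G)) (hinj : Function.Injective branch) (inner : W → W → Set V(G))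
    (hbranch : ∀ a b c, branch c ∉ inner a b)
    (hinner : ∀ a b a' b' x, x ∈ inner a b → x ∈ inner a' b' → a = a' ∧ b = b') (a₀ b₀ : W)
    (hpath : ∀ a b, a < b → ∃ q : G.toSimpleGraph.Walk (branch a) (branch b), q.IsPath ∧
      (∀ x ∈ q.support, x = branch a ∨ x = branch b ∨ x ∈ inner a b) ∧
      (2 < q.length → a = a₀ ∧ b = b₀)) :
    G.ContainsAlmostSubdivision (SimpleGraph.completeGraph W) := by
  choose P hP hsupp hlen using hpath
  have hlt : ∀ {a b : W}, (SimpleGraph.completeGraph W).Adj a b → ¬ a < b → b < a :=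
    fun h h' => lt_of_le_of_ne (not_lt.1 h') (Ne.symm h)
  let path : ∀ a b : W, (SimpleGraph.completeGraph W).Adj a b →
      G.toSimpleGraph.Walk (branch a) (branch b) := fun a b h =>
    if hab : a < b then P a b hab else (P b a (hlt h hab)).reverse
  have hsupp' : ∀ a b h, ∀ x ∈ (path a b h).support,
      x = branch a ∨ x = branch b ∨ x ∈ inner (min a b) (max a b) := by
    intro a b h x hx
    by_cases hab : a < b
    · simp only [path, dif_pos hab] at hx
      rw [min_eq_left hab.le, max_eq_right hab.le]
      exact hsupp a b hab x hx
    · have hba := hlt h hab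
      simp only [path, dif_neg hab, SimpleGraph.Walk.support_reverse, List.mem_reverse] at hx
      rw [min_eq_right hba.le, max_eq_left hba.le]
      rcases hsupp b a hba x hx with h | h | h <;> simp [h]
  have hlen' : ∀ a b h, 2 < (path a b h).length → s(a, b) = s(a₀, b₀) := by
    intro a b h hl
    by_cases hab : a < b
    · simp only [path, dif_pos hab] at hl
      obtain ⟨rfl, rfl⟩ := hlen a b hab hl
      rfl
    · simp only [path, dif_neg hab, SimpleGraph.Walk.length_reverse] at hl
      obtain ⟨rfl, rfl⟩ := hlen b a (hlt h hab) hl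
      exact Sym2.eq_swap
  have hsym : ∀ a b a' b' : W, min a b = min a' b' → max a b = max a' b' →
      s(a, b) = s(a', b') := by
    intro a b a' b' h1 h2
    rw [Sym2.eq_iff]
    rcases le_total a b with h | h <;> rcases le_total a' b' with h' | h' <;>
      simp only [h, h', min_eq_left, min_eq_right, max_eq_left, max_eq_right] at h1 h2 <;>
      simp [h1, h2]
  refine ⟨⟨branch, hinj, path, fun a b h => ?_, fun a b h => ?_, fun a b h c hc => ?_,
    fun a b h a' b' h' hne x hx hx' => ?_⟩, fun a b h a' b' h' hl hl' => ?_⟩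
  · by_cases hab : a < b
    · simp only [path, dif_pos hab]
      exact hP a b hab
    · simp only [path, dif_neg hab]
      exact (hP b a _).reverse
  · by_cases hab : a < b
    · simp only [path, dif_pos hab, dif_neg hab.not_gt]
    · simp only [path, dif_neg hab, dif_pos (hlt h hab), SimpleGraph.Walk.reverse_reverse]
  · rcases hsupp' a b h _ hc with h | h | h
    · exact Or.inl (hinj h)
    · exact Or.inr (hinj h)
    · exact (hbranch _ _ _ h).elim
  · rcases hsupp' a b h x hx with h1 | h1 | h1
    · exact ⟨a, h1⟩
    · exact ⟨b, h1⟩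
    rcases hsupp' a' b' h' x hx' with h2 | h2 | h2
    · exact ⟨a', h2⟩
    · exact ⟨b', h2⟩
    · obtain ⟨h3, h4⟩ := hinner _ _ _ _ x h1 h2
      exact (hne (hsym a b a' b' h3 h4)).elim
  · simp only [SubdivisionIn.count] at hl hl'
    rw [hlen' a b h (by omega), hlen' a' b' h' (by omega)]

end Graph

namespace SimpleGraph

lemma ReachIn.exists_walk {V : Type*} {Γ : SimpleGraph V} {S : Set V} {x y : V}
    (h : Γ.ReachIn S x y) (hx : x ∈ S) : ∃ q : Γ.Walk x y, ∀ z ∈ q.support, z ∈ S := by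
  induction h with
  | refl => exact ⟨.nil, by simpa using hx⟩
  | tail _ h ih =>
    obtain ⟨q, hq⟩ := ih
    refine ⟨q.concat h.1, fun z hz => ?_⟩
    rw [Walk.support_concat, List.mem_append, List.mem_singleton] at hz
    rcases hz with hz | rfl
    · exact hq z hz
    · exact h.2.2

/-- Two vertices of `B` that are joined outside `A` yield two vertices of `B` joined by a path
outside `A` with no inner vertex in `B`. -/
lemma exists_path_between {V : Type*} {Γ : SimpleGraph V} {A B : Set V} {x y : V} (hx : x ∈ B)
    (hy : y ∈ B) (hxy : x ≠ y) (hxA : x ∉ A) (h : Γ.ReachIn Aᶜ x y) :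
    ∃ u ∈ B, ∃ v ∈ B, u ≠ v ∧ ∃ q : Γ.Walk u v, q.IsPath ∧
      ∀ z ∈ q.support, z ∉ A ∧ (z ∈ B → z = u ∨ z = v) := by
  classical
  let S : ℕ → Prop := fun n => ∃ u ∈ B, ∃ v ∈ B, u ≠ v ∧ ∃ q : Γ.Walk u v, q.length = n ∧
    ∀ z ∈ q.support, z ∉ A
  have hS : ∃ n, S n := by
    obtain ⟨q, hq⟩ := h.exists_walk hxA
    exact ⟨_, x, hx, y, hy, hxy, q, rfl, hq⟩
  obtain ⟨u, hu, v, hv, huv, q, hlen, hq⟩ := Nat.find_spec hS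
  have hsub := q.support_bypass_subset_support
  refine ⟨u, hu, v, hv, huv, q.bypass, q.bypass_isPath, fun z hz => ⟨hq z (hsub hz), fun hzB => ?_⟩⟩
  by_contra hne
  push Not at hne
  have h1 := q.bypass.length_takeUntil_lt_length hz hne.2
  have h2 := q.length_bypass_le_length
  exact Nat.find_min hS (m := (q.bypass.takeUntil z hz).length) (by omega)
    ⟨u, hu, z, hzB, hne.1.symm, _, rfl, fun y hy =>
      hq y (hsub (q.bypass.support_takeUntil_subset_support hz hy))⟩

end SimpleGraph

namespace Graph

variable {α : Type u} {β : Type v}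

/-- If `p` vertices have many common neighbours and two of these are joined by a path avoiding the
`p` vertices, then these `p + 2` vertices are the branch vertices of an almost
`(≤ 1)`-subdivision of the complete graph: edges between the `p` vertices are subdivided once, by
further common neighbours, and the only long path is the one between the two common neighbours. -/
theorem containsAlmostSubdivision_of_common {G : Graph α β} {p : ℕ} {A B : Finset V(G)}
    (hA : A.card = p) (hB : p * p + 2 ≤ B.card)
    (hAB : ∀ b ∈ B, ∀ a ∈ A, G.toSimpleGraph.Adj b a) {x y : V(G)} (hx : x ∈ B) (hy : y ∈ B)
    (hxy : x ≠ y) (h : G.toSimpleGraph.ReachIn (A : Set V(G))ᶜ x y) :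
    G.ContainsAlmostSubdivision (SimpleGraph.completeGraph (Fin (p + 2))) := by
  classical
  have hdisj : ∀ b ∈ B, b ∉ A := fun b hb hb' => (hAB b hb b hb').ne rfl
  obtain ⟨u, hu, v, hv, huv, q, hq, hqA⟩ := SimpleGraph.exists_path_between (B := (B : Set V(G)))
    hx hy hxy (hdisj x hx) h
  rw [Finset.mem_coe] at hu hv
  obtain ⟨mid⟩ : Nonempty (Fin p × Fin p ↪ ↥((B.erase u).erase v)) := by
    apply Function.Embedding.nonempty_of_card_le
    rw [Fintype.card_prod, Fintype.card_fin, Fintype.card_coe,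
      Finset.card_erase_of_mem (Finset.mem_erase.2 ⟨huv.symm, hv⟩), Finset.card_erase_of_mem hu]
    omega
  have hmid : ∀ k, ((mid k : V(G)) ≠ v ∧ (mid k : V(G)) ≠ u) ∧ (mid k : V(G)) ∈ B := by
    intro k
    have := (mid k).2
    simp only [Finset.mem_erase] at this
    exact ⟨⟨this.1, this.2.1⟩, this.2.2⟩
  have hmidinj : ∀ k l, (mid k : V(G)) = mid l → k = l := fun k l h =>
    mid.injective (Subtype.ext h)
  let a : Fin p → V(G) := fun i => (A.equivFinOfCardEq hA).symm i
  have ha : ∀ i, a i ∈ A := fun i => ((A.equivFinOfCardEq hA).symm i).2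
  have hainj : Function.Injective a := fun i j h =>
    (A.equivFinOfCardEq hA).symm.injective (Subtype.ext h)
  have haB : ∀ i, a i ∉ B := fun i h => hdisj _ h (ha i)
  let branch : Fin (p + 2) → V(G) := Fin.cons u (Fin.cons v a)
  let inner : Fin (p + 2) → Fin (p + 2) → Set V(G) := fun i j =>
    {z | (i = 0 ∧ j = 1 ∧ z ∉ A ∧ z ∉ B) ∨
      ∃ k l : Fin p, i = k.succ.succ ∧ j = l.succ.succ ∧ z = mid (k, l)}
  have hcase : ∀ c : Fin (p + 2), c = 0 ∨ c = 1 ∨ ∃ k : Fin p, c = k.succ.succ := by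
    intro c
    induction c using Fin.cases with
    | zero => exact Or.inl rfl
    | succ c =>
      induction c using Fin.cases with
      | zero => exact Or.inr (Or.inl rfl)
      | succ c => exact Or.inr (Or.inr ⟨c, rfl⟩)
  have hb0 : branch 0 = u := rfl
  have hb1 : branch 1 = v := rfl
  have hb2 : ∀ k : Fin p, branch k.succ.succ = a k := fun k => rfl
  refine containsAlmostSubdivision_of_lt branch ?_ inner ?_ ?_ 0 1 ?_
  · intro c d hcd
    rcases hcase c with rfl | rfl | ⟨k, rfl⟩ <;> rcases hcase d with rfl | rfl | ⟨l, rfl⟩ <;>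
      simp only [hb0, hb1, hb2] at hcd
    · rfl
    · exact absurd hcd huv
    · exact absurd (hcd ▸ hu) (haB l)
    · exact absurd hcd.symm huv
    · rfl
    · exact absurd (hcd ▸ hv) (haB l)
    · exact absurd (hcd ▸ hu) (haB k)
    · exact absurd (hcd ▸ hv) (haB k)
    · rw [hainj hcd]
  · rintro i j c (⟨-, -, h1, h2⟩ | ⟨k, l, -, -, h1⟩)
    · rcases hcase c with rfl | rfl | ⟨k, rfl⟩
      · exact h2 hu
      · exact h2 hv
      · exact h1 (ha k)
    · obtain ⟨⟨h2, h3⟩, h4⟩ := hmid (k, l)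
      rcases hcase c with rfl | rfl | ⟨k, rfl⟩
      · exact h3 h1.symm
      · exact h2 h1.symm
      · exact haB k ((hb2 k).symm.trans h1 ▸ h4)
  · rintro i j i' j' z (⟨rfl, rfl, h1, h2⟩ | ⟨k, l, rfl, rfl, h1⟩)
      (⟨rfl, rfl, h3, h4⟩ | ⟨k', l', rfl, rfl, h3⟩)
    · exact ⟨rfl, rfl⟩
    · exact absurd (h3 ▸ (hmid _).2) h2
    · exact absurd (h1 ▸ (hmid _).2) h4
    · have := hmidinj _ _ (h1.symm.trans h3)
      rw [Prod.mk.injEq] at this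
      rw [this.1, this.2]
      exact ⟨rfl, rfl⟩
  · intro i j hij
    have edge : ∀ {s t : V(G)} (_ : G.toSimpleGraph.Adj s t) (I : Set V(G)) (P : Prop),
        ∃ q : G.toSimpleGraph.Walk s t, q.IsPath ∧ (∀ x ∈ q.support, x = s ∨ x = t ∨ x ∈ I) ∧
          (2 < q.length → P) := by
      intro s t hst I P
      refine ⟨.cons hst .nil, by simp [hst.ne], fun x hx => ?_, by simp⟩
      simp only [SimpleGraph.Walk.support_cons, SimpleGraph.Walk.support_nil, List.mem_cons,
        List.not_mem_nil, or_false] at hx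
      tauto
    have two : ∀ {s m t : V(G)} (_ : G.toSimpleGraph.Adj s m) (_ : G.toSimpleGraph.Adj m t)
        (_ : s ≠ t) {I I' : Set V(G)} {P : Prop} (_ : m ∈ I'),
        ∃ q : G.toSimpleGraph.Walk s t, q.IsPath ∧
          (∀ x ∈ q.support, x = s ∨ x = t ∨ x ∈ I ∪ I') ∧ (2 < q.length → P) := by
      intro s m t h1 h2 hst I I' P hm
      refine ⟨.cons h1 (.cons h2 .nil), ?_, fun x hx => ?_, by simp⟩
      · simp only [SimpleGraph.Walk.isPath_def, SimpleGraph.Walk.support_cons,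
          SimpleGraph.Walk.support_nil]
        simpa using ⟨⟨h1.ne, hst⟩, h2.ne⟩
      · simp only [SimpleGraph.Walk.support_cons, SimpleGraph.Walk.support_nil, List.mem_cons,
          List.not_mem_nil, or_false] at hx
        rcases hx with rfl | rfl | rfl
        · exact Or.inl rfl
        · exact Or.inr (Or.inr (Or.inr hm))
        · exact Or.inr (Or.inl rfl)
    rcases hcase i with rfl | rfl | ⟨k, rfl⟩ <;> rcases hcase j with rfl | rfl | ⟨l, rfl⟩
    · exact absurd hij (lt_irrefl _)
    · refine ⟨q, hq, fun z hz => ?_, fun _ => ⟨rfl, rfl⟩⟩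
      by_cases hzB : z ∈ B
      · rcases (hqA z hz).2 hzB with h | h
        · exact Or.inl h
        · exact Or.inr (Or.inl h)
      · exact Or.inr (Or.inr (Or.inl ⟨rfl, rfl, (hqA z hz).1, hzB⟩))
    · exact edge (hAB u hu _ (ha l)) _ _
    · exact absurd hij (Fin.not_lt_zero _)
    · exact absurd hij (lt_irrefl _)
    · exact edge (hAB v hv _ (ha l)) _ _
    · exact absurd hij (Fin.not_lt_zero _)
    · rw [Fin.lt_def] at hij
      simp at hij
    · obtain ⟨-, hm⟩ := hmid (k, l)
      have hkl : a k ≠ a l := fun h => by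
        rw [hainj h] at hij
        exact lt_irrefl _ hij
      exact two (hAB _ hm _ (ha k)).symm (hAB _ hm _ (ha l)) hkl ⟨k, l, rfl, rfl, rfl⟩

end Graph

namespace SimpleGraph

variable {V : Type*} {Γ : SimpleGraph V}

open scoped Classical

/-! ### Monochromatic reachability -/

variable (Γ) in
/-- `Γ.MonoIn c S x y`: the vertices `x` and `y` are equal or are joined by a walk of `Γ` that has
all its vertices in `S` and is monochromatic under `c`. -/
def MonoIn (c : V → ℤ) (S : Set V) : V → V → Prop :=
  Relation.ReflTransGen fun a b => Γ.Adj a b ∧ a ∈ S ∧ b ∈ S ∧ c a = c b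

lemma MonoIn.symm {c : V → ℤ} {S : Set V} {x y : V} (h : Γ.MonoIn c S x y) :
    Γ.MonoIn c S y x := by
  induction h with
  | refl => exact .refl
  | tail _ h ih => exact .head ⟨h.1.symm, h.2.2.1, h.2.1, h.2.2.2.symm⟩ ih

lemma MonoIn.color_eq {c : V → ℤ} {S : Set V} {x y : V} (h : Γ.MonoIn c S x y) : c x = c y := by
  induction h with
  | refl => rfl
  | tail _ h ih => exact ih.trans h.2.2.2

lemma MonoIn.mono {c c' : V → ℤ} {S S' : Set V} {x y : V} (hS : S ⊆ S') (hc : ∀ z ∈ S, c z = c' z)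
    (h : Γ.MonoIn c S x y) : Γ.MonoIn c' S' x y := by
  induction h with
  | refl => exact .refl
  | tail _ h ih =>
    refine ih.tail ⟨h.1, hS h.2.1, hS h.2.2.1, ?_⟩
    rw [← hc _ h.2.1, ← hc _ h.2.2.1, h.2.2.2]

/-! ### Counting vertices with many neighbours in a small set -/

variable (Γ) in
/-- The neighbours of `v` in `Y`. -/
noncomputable def nbIn (Y : Finset V) (v : V) : Finset V :=
  Y.filter (Γ.Adj v)

lemma mem_nbIn {Y : Finset V} {v y : V} : y ∈ Γ.nbIn Y v ↔ y ∈ Y ∧ Γ.Adj v y := by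
  simp [nbIn]

variable [Fintype V]

variable (Γ) in
/-- The common neighbours of the vertices in `A`. -/
noncomputable def commonNb (A : Finset V) : Finset V :=
  Finset.univ.filter fun v => ∀ a ∈ A, Γ.Adj v a

variable (Γ) in
/-- Every set of `p` vertices with at least `T` common neighbours separates these common neighbours
from each other. -/
def SeparatesCommonNb (p T : ℕ) : Prop :=
  ∀ A : Finset V, A.card = p → T ≤ (Γ.commonNb A).card → ∀ x ∈ Γ.commonNb A, ∀ y ∈ Γ.commonNb A,
    Γ.ReachIn (A : Set V)ᶜ x y → x = y

lemma mem_commonNb {A : Finset V} {v : V} : v ∈ Γ.commonNb A ↔ ∀ a ∈ A, Γ.Adj v a := by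
  simp [commonNb]

/-- A set `A ⊆ Y` of `p` vertices with at least `T` common neighbours contributes at most one vertex
for each component outside `A` that meets `Y'`; all other sets of `p` vertices contribute less
than `T` vertices. -/
lemma SeparatesCommonNb.card_le {p T : ℕ} (hΓ : Γ.SeparatesCommonNb p T) (P Y Y' : Finset V)
    (hdeg : ∀ v ∈ P, p ≤ (Γ.nbIn Y v).card)
    (hreach : ∀ v ∈ P, ∀ A ⊆ Γ.nbIn Y v, A.card = p → T ≤ (Γ.commonNb A).card →
      ∃ y ∈ Y', Γ.ReachIn (A : Set V)ᶜ v y) :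
    P.card ≤ 2 ^ Y.card * (T + Y'.card) := by
  have hsub : P ⊆ (Y.powersetCard p).biUnion fun A => P.filter fun v => A ⊆ Γ.nbIn Y v := by
    intro v hv
    obtain ⟨A, hA, hAp⟩ := Finset.exists_subset_card_eq (hdeg v hv)
    rw [Finset.mem_biUnion]
    exact ⟨A, Finset.mem_powersetCard.2 ⟨hA.trans (Finset.filter_subset _ _), hAp⟩,
      Finset.mem_filter.2 ⟨hv, hA⟩⟩
  refine (Finset.card_le_card hsub).trans ((Finset.card_biUnion_le_card_mul _ _ (T + Y'.card)
    fun A hA => ?_).trans (Nat.mul_le_mul_right _ ?_))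
  · obtain ⟨-, hAp⟩ := Finset.mem_powersetCard.1 hA
    have hcom : ∀ v ∈ P.filter (fun v => A ⊆ Γ.nbIn Y v), v ∈ Γ.commonNb A := fun v hv =>
      mem_commonNb.2 fun a ha => (mem_nbIn.1 ((Finset.mem_filter.1 hv).2 ha)).2
    by_cases hT : T ≤ (Γ.commonNb A).card
    · refine le_trans ?_ (Nat.le_add_left _ _)
      have hr : ∀ v ∈ P.filter (fun v => A ⊆ Γ.nbIn Y v), ∃ y ∈ Y',
          Γ.ReachIn (A : Set V)ᶜ v y := fun v hv =>
        hreach v (Finset.mem_filter.1 hv).1 A (Finset.mem_filter.1 hv).2 hAp hT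
      choose! f hf hf' using hr
      refine Finset.card_le_card_of_injOn f hf fun x hx y hy hxy => ?_
      refine hΓ A hAp hT x (hcom x hx) y (hcom y hy) ?_
      exact (hf' x hx).trans (hxy ▸ (hf' y hy).symm)
    · refine le_trans (Finset.card_le_card fun v hv => hcom v hv) (by omega)
  · rw [Finset.card_powersetCard]
    exact Nat.choose_le_two_pow _ _

/-! ### Components inside a set of vertices -/

variable (Γ) in
/-- The component of `v` in the subgraph induced by `U`. -/
noncomputable def compIn (U : Finset V) (v : V) : Finset V :=
  Finset.univ.filter (Γ.ReachIn U v)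

lemma mem_compIn {U : Finset V} {v x : V} : x ∈ Γ.compIn U v ↔ Γ.ReachIn U v x := by
  simp [compIn]

lemma self_mem_compIn (U : Finset V) (v : V) : v ∈ Γ.compIn U v :=
  mem_compIn.2 .refl

lemma compIn_subset {U : Finset V} {v : V} (hv : v ∈ U) : Γ.compIn U v ⊆ U :=
  fun _ hx => (mem_compIn.1 hx).mem hv

lemma compIn_eq {U : Finset V} {v x : V} (hx : x ∈ Γ.compIn U v) :
    Γ.compIn U x = Γ.compIn U v := by
  ext y
  rw [mem_compIn, mem_compIn]
  exact ⟨fun h => (mem_compIn.1 hx).trans h, fun h => (mem_compIn.1 hx).symm.trans h⟩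

lemma mem_compIn_of_adj {U : Finset V} {v x y : V} (hv : v ∈ U) (hx : x ∈ Γ.compIn U v)
    (h : Γ.Adj x y) (hy : y ∈ U) : y ∈ Γ.compIn U v :=
  mem_compIn.2 ((mem_compIn.1 hx).tail ⟨h, compIn_subset hv hx, hy⟩)

lemma reachIn_compIn {U : Finset V} {v : V} (hv : v ∈ U) :
    ∀ x ∈ Γ.compIn U v, ∀ y ∈ Γ.compIn U v, Γ.ReachIn (Γ.compIn U v) x y := by
  have key : ∀ x, Γ.ReachIn U v x → Γ.ReachIn (Γ.compIn U v) v x := by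
    intro x hx
    induction hx with
    | refl => exact .refl
    | tail h h' ih =>
      exact ih.tail ⟨h'.1, mem_compIn.2 h, mem_compIn_of_adj hv (mem_compIn.2 h) h'.1 h'.2.2⟩
  exact fun x hx y hy => (key x (mem_compIn.1 hx)).symm.trans (key y (mem_compIn.1 hy))

lemma notMem_of_mem_bdry_compIn {U : Finset V} {v y : V} (hv : v ∈ U)
    (hy : y ∈ Γ.bdry (Γ.compIn U v)) : y ∉ U := by
  obtain ⟨h, x, hx, hxy⟩ := mem_bdry.1 hy
  exact fun h' => h (mem_compIn_of_adj hv hx hxy h')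

lemma bdry_compIn_subset {K W : Finset V} {v : V} (hv : v ∈ K \ W) :
    Γ.bdry (Γ.compIn (K \ W) v) ⊆ Γ.bdry K ∪ W := by
  intro y hy
  have h := notMem_of_mem_bdry_compIn hv hy
  obtain ⟨-, x, hx, hxy⟩ := mem_bdry.1 hy
  have hxK := (Finset.mem_sdiff.1 (compIn_subset hv hx)).1
  rw [Finset.mem_union]
  by_cases hyK : y ∈ K
  · exact Or.inr (by_contra fun h' => h (Finset.mem_sdiff.2 ⟨hyK, h'⟩))
  · exact Or.inl (mem_bdry.2 ⟨hyK, x, hxK, hxy⟩)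

/-! ### Vertices reached from the boundary -/

variable (Γ) in
/-- The vertices of `K` that a monochromatic walk in `K` and its boundary joins to a vertex in
`Src`. -/
noncomputable def reached (c : V → ℤ) (K Src : Finset V) : Finset V :=
  K.filter fun x => ∃ y ∈ Src, Γ.MonoIn c (K ∪ Γ.bdry K : Finset V) y x

lemma mem_reached {c : V → ℤ} {K Src : Finset V} {x : V} :
    x ∈ Γ.reached c K Src ↔ x ∈ K ∧ ∃ y ∈ Src, Γ.MonoIn c (K ∪ Γ.bdry K : Finset V) y x := by
  simp only [reached, Finset.mem_filter]

lemma reached_mono {c : V → ℤ} {K Src Src' : Finset V} (h : Src ⊆ Src') :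
    Γ.reached c K Src ⊆ Γ.reached c K Src' := by
  intro x hx
  obtain ⟨hxK, y, hy, hyx⟩ := mem_reached.1 hx
  exact mem_reached.2 ⟨hxK, y, h hy, hyx⟩

lemma reached_congr {c c' : V → ℤ} {K Src : Finset V} (h : ∀ z ∈ K ∪ Γ.bdry K, c z = c' z) :
    Γ.reached c K Src = Γ.reached c' K Src := by
  ext x
  rw [mem_reached, mem_reached]
  refine and_congr_right fun _ => exists_congr fun y => and_congr_right fun _ => ?_
  exact ⟨MonoIn.mono subset_rfl h, MonoIn.mono subset_rfl fun z hz => (h z hz).symm⟩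

/-- Let `P` contain every vertex of `K \ W` that has the same colour as some neighbour in
`Γ.bdry K ∪ W`. A monochromatic walk from `Γ.bdry K ∪ W` can only enter a component of `K \ W`
through a vertex in `P`. -/
lemma reached_subset {c : V → ℤ} {K W P Src : Finset V} {R : Finset ℤ}
    (hP : ∀ v ∈ K \ W, ∀ y ∈ Γ.bdry (Γ.compIn (K \ W) v), Γ.Adj v y → c v = c y → v ∈ P)
    (hSrc : Src ⊆ Γ.bdry K ∪ W) (hR : ∀ y ∈ Src, c y ∈ R) :
    Γ.reached c K Src ⊆ W ∪ P.biUnion fun v => Γ.reached c (Γ.compIn (K \ W) v)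
      ((Γ.bdry (Γ.compIn (K \ W) v)).filter (c · ∈ R)) := by
  intro x hx
  obtain ⟨hxK, y, hy, hyx⟩ := mem_reached.1 hx
  have key : ∀ z, Γ.MonoIn c (K ∪ Γ.bdry K : Finset V) y z → z ∈ Γ.bdry K ∪ W ∨
      z ∈ K \ W ∧ ∃ v ∈ P, z ∈ Γ.reached c (Γ.compIn (K \ W) v)
        ((Γ.bdry (Γ.compIn (K \ W) v)).filter (c · ∈ R)) := by
    intro z hz
    induction hz with
    | refl => exact Or.inl (hSrc hy)
    | @tail z z' hyz h ih =>
      obtain ⟨hadj, -, hz', hc⟩ := h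
      by_cases hz'U : z' ∈ K \ W
      · refine Or.inr ⟨hz'U, ?_⟩
        rcases ih with hz | ⟨hzU, v, hv, hz⟩
        · have hzU : z ∉ K \ W := by
            intro h
            rw [Finset.mem_sdiff] at h
            rcases Finset.mem_union.1 hz with h' | h'
            · exact (mem_bdry.1 h').1 h.1
            · exact h.2 h'
          have hzb : z ∈ Γ.bdry (Γ.compIn (K \ W) z') :=
            mem_bdry.2 ⟨fun h => hzU (compIn_subset hz'U h), z', self_mem_compIn _ _, hadj.symm⟩
          refine ⟨z', hP z' hz'U z hzb hadj.symm hc.symm, mem_reached.2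
            ⟨self_mem_compIn _ _, z, Finset.mem_filter.2 ⟨hzb, ?_⟩, ?_⟩⟩
          · rw [← MonoIn.color_eq hyz]
            exact hR y hy
          · exact .single ⟨hadj, Finset.mem_union_right _ hzb,
              Finset.mem_union_left _ (self_mem_compIn _ _), hc⟩
        · obtain ⟨hzC, t, ht, htz⟩ := mem_reached.1 hz
          have hz'C : z' ∈ Γ.compIn (K \ W) v := by
            rw [← compIn_eq hzC]
            exact mem_compIn_of_adj hzU (self_mem_compIn _ _) hadj hz'U
          exact ⟨v, hv, mem_reached.2 ⟨hz'C, t, ht, htz.tail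
            ⟨hadj, Finset.mem_union_left _ hzC, Finset.mem_union_left _ hz'C, hc⟩⟩⟩
      · left
        rw [Finset.mem_coe] at hz'
        simp only [Finset.mem_union, Finset.mem_sdiff, not_and_not_right] at hz' hz'U ⊢
        tauto
  rw [Finset.mem_union, Finset.mem_biUnion]
  rcases key x hyx with h | ⟨-, h⟩
  · rcases Finset.mem_union.1 h with h | h
    · exact absurd hxK (mem_bdry.1 h).1
    · exact Or.inl h
  · exact Or.inr h

end SimpleGraph

namespace SimpleGraph

variable {V : Type*} [Fintype V] {Γ : SimpleGraph V}

open scoped Classical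

/-! ### The list-colouring argument -/

/-- The lists `L` on `K` fit the colouring `c` of the boundary of `K`: a vertex with fewer than `p`
neighbours in the boundary has lost at most one colour for each of these, and has lost all their
colours; any other vertex has two colours left, or has lost all colours of these neighbours. -/
structure Admissible (Γ : SimpleGraph V) (p : ℕ) (K : Finset V) (c : V → ℤ) (L : V → Finset ℤ) :
    Prop where
  few : ∀ v ∈ K, (Γ.nbIn (Γ.bdry K) v).card < p →
    p + 1 ≤ (L v).card + (Γ.nbIn (Γ.bdry K) v).card ∧ ∀ y ∈ Γ.nbIn (Γ.bdry K) v, c y ∉ L v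
  many : ∀ v ∈ K, p ≤ (Γ.nbIn (Γ.bdry K) v).card →
    2 ≤ (L v).card ∨ (L v).Nonempty ∧ ∀ y ∈ Γ.nbIn (Γ.bdry K) v, c y ∉ L v

/-- The vertices of `K` that have at least `p` neighbours in the boundary of `K`. -/
noncomputable def crowded (Γ : SimpleGraph V) (p : ℕ) (K : Finset V) : Finset V :=
  K.filter fun v => p ≤ (Γ.nbIn (Γ.bdry K) v).card

lemma mem_crowded {p : ℕ} {K : Finset V} {v : V} :
    v ∈ Γ.crowded p K ↔ v ∈ K ∧ p ≤ (Γ.nbIn (Γ.bdry K) v).card := by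
  simp [crowded]

/-- The boundary of `K` consists of `p` vertices with at least `T` common neighbours. -/
def IsRichlyBounded (Γ : SimpleGraph V) (p T : ℕ) (K : Finset V) : Prop :=
  (Γ.bdry K).card = p ∧ T ≤ (Γ.commonNb (Γ.bdry K)).card

lemma Admissible.exists_color {p : ℕ} {K : Finset V} {c : V → ℤ} {L : V → Finset ℤ}
    (h : Γ.Admissible p K c L) (c₀ : ℤ) {v : V} (hv : v ∈ K) :
    ∃ i ∈ L v, ∀ y ∈ Γ.nbIn (Γ.bdry K) v, i = c y → i ≠ c₀ := by
  by_cases hp : p ≤ (Γ.nbIn (Γ.bdry K) v).card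
  · rcases h.many v hv hp with h2 | ⟨⟨i, hi⟩, havoid⟩
    · obtain ⟨i, hi, hne⟩ := Finset.exists_mem_ne h2 c₀
      exact ⟨i, hi, fun _ _ _ => hne⟩
    · exact ⟨i, hi, fun y hy hiy => absurd (hiy ▸ hi) (havoid y hy)⟩
  · obtain ⟨h1, havoid⟩ := h.few v hv (not_le.1 hp)
    obtain ⟨i, hi⟩ : (L v).Nonempty := Finset.card_pos.1 (by omega)
    exact ⟨i, hi, fun y hy hiy => absurd (hiy ▸ hi) (havoid y hy)⟩

/-- The lists on `K \ W` after `W` has been coloured: each vertex loses the colours of its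
neighbours in the boundary of its component of `K \ W`, except that vertices with at least `p` such
neighbours keep their lists, unless that boundary consists of `p` vertices with at least `T` common
neighbours. -/
noncomputable def reducedLists (Γ : SimpleGraph V) (p T : ℕ) (U : Finset V) (c : V → ℤ)
    (L : V → Finset ℤ) (v : V) : Finset ℤ :=
  if v ∈ Γ.crowded p (Γ.compIn U v) ∧ ¬ Γ.IsRichlyBounded p T (Γ.compIn U v) then L v
  else L v \ (Γ.nbIn (Γ.bdry (Γ.compIn U v)) v).image c

lemma reducedLists_subset (p T : ℕ) (U : Finset V) (c : V → ℤ) (L : V → Finset ℤ) (v : V) :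
    Γ.reducedLists p T U c L v ⊆ L v := by
  unfold reducedLists
  split_ifs
  · exact subset_rfl
  · exact Finset.sdiff_subset

lemma Admissible.reducedLists {p T : ℕ} {K W : Finset V} {c c₁ : V → ℤ} {L : V → Finset ℤ}
    (h : Γ.Admissible p K c L) (hW : Γ.crowded p K ⊆ W) (hWK : W ⊆ K) (hc : ∀ v ∉ W, c₁ v = c v)
    {x : V} (hx : x ∈ K \ W) :
    Γ.Admissible p (Γ.compIn (K \ W) x) c₁ (Γ.reducedLists p T (K \ W) c₁ L) := by
  have hmem : ∀ v ∈ Γ.compIn (K \ W) x, v ∈ K ∧ v ∉ W := fun v hv =>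
    Finset.mem_sdiff.1 (compIn_subset hx hv)
  have hfew : ∀ v ∈ Γ.compIn (K \ W) x, (Γ.nbIn (Γ.bdry K) v).card < p := fun v hv =>
    not_le.1 fun h' => (hmem v hv).2 (hW (mem_crowded.2 ⟨(hmem v hv).1, h'⟩))
  have hcard : ∀ v ∈ Γ.compIn (K \ W) x, p + 1 ≤
      (L v \ (Γ.nbIn (Γ.bdry (Γ.compIn (K \ W) x)) v).image c₁).card +
        (Γ.nbIn (Γ.bdry (Γ.compIn (K \ W) x)) v).card := by
    intro v hv
    obtain ⟨h1, havoid⟩ := h.few v (hmem v hv).1 (hfew v hv)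
    set N := Γ.nbIn (Γ.bdry K) v
    set N' := Γ.nbIn (Γ.bdry (Γ.compIn (K \ W) x)) v
    have hNN' : N ⊆ N' := by
      intro y hy
      obtain ⟨hyK, hvy⟩ := mem_nbIn.1 hy
      refine mem_nbIn.2 ⟨mem_bdry.2 ⟨fun h' => ?_, v, hv, hvy⟩, hvy⟩
      exact (mem_bdry.1 hyK).1 (hmem y h').1
    -- the colours of the neighbours in the boundary of `K` are not in `L v`
    have hsub : L v \ (N' \ N).image c₁ ⊆ L v \ N'.image c₁ := by
      intro i hi
      rw [Finset.mem_sdiff] at hi ⊢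
      refine ⟨hi.1, fun hi' => ?_⟩
      obtain ⟨y, hy, rfl⟩ := Finset.mem_image.1 hi'
      by_cases hyN : y ∈ N
      · refine havoid y hyN ?_
        rw [← hc y fun h' => (mem_bdry.1 (mem_nbIn.1 hyN).1).1 (hWK h')]
        exact hi.1
      · exact hi.2 (Finset.mem_image_of_mem _ (Finset.mem_sdiff.2 ⟨hy, hyN⟩))
    have h2 := Finset.card_le_card hsub
    have h3 := Finset.le_card_sdiff ((N' \ N).image c₁) (L v)
    have h4 : ((N' \ N).image c₁).card ≤ (N' \ N).card := Finset.card_image_le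
    have h5 := Finset.card_sdiff_add_card_eq_card hNN'
    omega
  have havoid : ∀ v, ∀ y ∈ Γ.nbIn (Γ.bdry (Γ.compIn (K \ W) x)) v,
      c₁ y ∉ L v \ (Γ.nbIn (Γ.bdry (Γ.compIn (K \ W) x)) v).image c₁ := fun v y hy hy' =>
    (Finset.mem_sdiff.1 hy').2 (Finset.mem_image_of_mem _ hy)
  refine ⟨fun v hv hp => ?_, fun v hv hp => ?_⟩
  · have : ¬ (v ∈ Γ.crowded p (Γ.compIn (K \ W) v) ∧
        ¬ Γ.IsRichlyBounded p T (Γ.compIn (K \ W) v)) := by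
      rw [compIn_eq hv, mem_crowded]
      omega
    rw [SimpleGraph.reducedLists, if_neg this, compIn_eq hv]
    exact ⟨hcard v hv, havoid v⟩
  · by_cases hr : Γ.IsRichlyBounded p T (Γ.compIn (K \ W) x)
    · rw [SimpleGraph.reducedLists, compIn_eq hv, if_neg fun h => h.2 hr]
      refine Or.inr ⟨Finset.card_pos.1 ?_, havoid v⟩
      have h1 := hcard v hv
      have h2 : (Γ.nbIn (Γ.bdry (Γ.compIn (K \ W) x)) v).card ≤ p :=
        (Finset.card_le_card (Finset.filter_subset _ _)).trans hr.1.le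
      omega
    · rw [SimpleGraph.reducedLists, compIn_eq hv, if_pos ⟨mem_crowded.2 ⟨hv, hp⟩, hr⟩]
      have := (h.few v (hmem v hv).1 (hfew v hv)).1
      have := hfew v hv
      exact Or.inl (by omega)

lemma crowded_compIn_card_le {p T : ℕ} (hΓ : Γ.SeparatesCommonNb p T) {U : Finset V} {x : V}
    (hx : x ∈ U) :
    (Γ.crowded p (Γ.compIn U x)).card ≤ 2 ^ (Γ.bdry (Γ.compIn U x)).card * (T + 1) := by
  refine hΓ.card_le _ (Γ.bdry (Γ.compIn U x)) {x} (fun v hv => (mem_crowded.1 hv).2) ?_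
  intro v hv A hA _ _
  refine ⟨x, Finset.mem_singleton_self x, ReachIn.mono (fun z hz hzA => ?_)
    (reachIn_compIn hx v (mem_crowded.1 hv).1 x (self_mem_compIn _ _))⟩
  exact (mem_bdry.1 (mem_nbIn.1 (hA hzA)).1).1 hz

/-- There are few vertices at which a monochromatic component may enter an uncoloured component: a
set of `p` of their coloured neighbours either has few common neighbours or is not the whole boundary
of the component, and then each of its common neighbours is joined to a further coloured vertex. -/
lemma card_leaks_le {p T : ℕ} (hΓ : Γ.SeparatesCommonNb p T) (K W : Finset V) :
    ((K \ W).filter fun v => v ∈ Γ.crowded p (Γ.compIn (K \ W) v) ∧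
      ¬ Γ.IsRichlyBounded p T (Γ.compIn (K \ W) v)).card ≤
      2 ^ (Γ.bdry K ∪ W).card * (T + (Γ.bdry K ∪ W).card) := by
  refine hΓ.card_le _ (Γ.bdry K ∪ W) (Γ.bdry K ∪ W) (fun v hv => ?_) fun v hv A hA hAp hAT => ?_
  · obtain ⟨hvU, hv, -⟩ := Finset.mem_filter.1 hv
    refine (mem_crowded.1 hv).2.trans (Finset.card_le_card fun y hy => ?_)
    exact mem_nbIn.2 ⟨bdry_compIn_subset hvU (mem_nbIn.1 hy).1, (mem_nbIn.1 hy).2⟩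
  · obtain ⟨hvU, hv, hr⟩ := Finset.mem_filter.1 hv
    have hAb : A ⊆ Γ.bdry (Γ.compIn (K \ W) v) := by
      intro y hy
      obtain ⟨h1, h2⟩ := mem_nbIn.1 (hA hy)
      refine mem_bdry.2 ⟨fun h => ?_, v, self_mem_compIn _ _, h2⟩
      have := Finset.mem_sdiff.1 (compIn_subset hvU h)
      rcases Finset.mem_union.1 h1 with h1 | h1
      · exact (mem_bdry.1 h1).1 this.1
      · exact this.2 h1
    -- `A` is not the whole boundary, and any other vertex of the boundary is reached outside `A`
    obtain ⟨y, hy, hyA⟩ : ∃ y ∈ Γ.bdry (Γ.compIn (K \ W) v), y ∉ A := by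
      by_contra! h
      have : A = Γ.bdry (Γ.compIn (K \ W) v) := hAb.antisymm h
      exact hr ⟨this ▸ hAp, this ▸ hAT⟩
    refine ⟨y, bdry_compIn_subset hvU hy, ?_⟩
    have hCA : ∀ z ∈ Γ.compIn (K \ W) v, z ∉ A := fun z hz hzA => (mem_bdry.1 (hAb hzA)).1 hz
    obtain ⟨-, t, ht, hty⟩ := mem_bdry.1 hy
    exact (ReachIn.mono (fun z hz => hCA z hz)
      (reachIn_compIn hvU v (self_mem_compIn _ _) t ht)).tail ⟨hty, hCA t ht, hyA⟩

/-- `reachBound F r` bounds the number of vertices reached through `r` further rounds of colouring,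
when each round colours at most `F` vertices and leaves at most `F` vertices at which a
monochromatic component may enter an uncoloured component. -/
def reachBound (F : ℕ) : ℕ → ℕ
  | 0 => 0
  | r + 1 => F + F * reachBound F r

lemma reachBound_mono (F : ℕ) : Monotone (reachBound F) := by
  refine monotone_nat_of_le_succ fun r => ?_
  induction r with
  | zero => exact Nat.zero_le _
  | succ r ih =>
    rw [reachBound, reachBound]
    exact Nat.add_le_add_left (Nat.mul_le_mul_left _ ih) _

/-- Extension of a colouring of the boundary of `K` to `K`. In each round the vertices with many
neighbours in the boundary are coloured, together with a bounded set that leaves only components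
with small boundary. The set `R` holds those colours of the boundary whose monochromatic components
still have to be stopped; one of them is stopped in each round, and when none is left, `R` is
renewed. Hence a component with colour in `R` is stopped after at most `R.card` rounds, any other one
that meets the boundary of `K` at most `θ` rounds after the renewal, and a component inside `K`
starts in some round, with at most `θ` colours still to be stopped before the renewal. -/
theorem exists_extension {p T θ F₁ F : ℕ} (hΓ : Γ.SeparatesCommonNb p T)
    (hcl : ∀ S : Finset V, S.card ≤ θ + 2 ^ θ * (T + 1) + 1 → ∃ S' : Finset V, S ⊆ S' ∧
      S'.card ≤ F₁ ∧ ∀ K B : Finset V, K.Nonempty → (∀ x ∈ K, ∀ y ∈ K, Γ.ReachIn K x y) →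
        Disjoint K S' → B ⊆ S' → B ⊆ Γ.bdry K → B.card ≤ θ)
    (hF₁ : F₁ ≤ F) (hF : 2 ^ F₁ * (T + F₁) ≤ F) (K : Finset V) :
    ∀ (c : V → ℤ) (L : V → Finset ℤ) (R : Finset ℤ), (Γ.bdry K).card ≤ θ →
      (Γ.crowded p K).card ≤ 2 ^ θ * (T + 1) → Γ.Admissible p K c L → R.card ≤ θ →
      ∃ c' : V → ℤ, (∀ v ∉ K, c' v = c v) ∧ (∀ v ∈ K, c' v ∈ L v) ∧
        (Γ.reached c' K ((Γ.bdry K).filter (c' · ∈ R))).card ≤ reachBound F R.card ∧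
        (Γ.reached c' K (Γ.bdry K)).card ≤ reachBound F (θ + 1 + R.card) ∧
        ∀ x ∈ K, (Finset.univ.filter (Γ.MonoIn c' K x)).card ≤ reachBound F (θ + 1 + θ) := by
  induction K using Finset.strongInduction with
  | H K ih =>
  intro c L R hbd hcr hadm hR
  rcases K.eq_empty_or_nonempty with rfl | ⟨x₀, hx₀⟩
  · exact ⟨c, by simp, by simp, by simp [reached], by simp [reached], by simp⟩
  obtain ⟨c₀, hc₀⟩ : ∃ c₀, R.Nonempty → c₀ ∈ R := by
    rcases R.eq_empty_or_nonempty with rfl | ⟨i, hi⟩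
    · exact ⟨0, fun h => absurd h Finset.not_nonempty_empty⟩
    · exact ⟨i, fun _ => hi⟩
  -- the set `W` of vertices to be coloured in this round
  obtain ⟨S', hSS', hS'card, hS'⟩ := hcl (Γ.bdry K ∪ Γ.crowded p K ∪ {x₀}) (by
    refine (Finset.card_union_le _ _).trans (Nat.add_le_add ((Finset.card_union_le _ _).trans
      (Nat.add_le_add hbd hcr)) (Finset.card_singleton _).le))
  let W := K ∩ S'
  let U := K \ W
  have hWK : W ⊆ K := Finset.inter_subset_left
  have hcrW : Γ.crowded p K ⊆ W := fun v hv => Finset.mem_inter.2 ⟨(mem_crowded.1 hv).1,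
    hSS' (Finset.mem_union_left _ (Finset.mem_union_right _ hv))⟩
  have hx₀W : x₀ ∈ W := Finset.mem_inter.2 ⟨hx₀, hSS' (Finset.mem_union_right _
    (Finset.mem_singleton_self _))⟩
  have hYS' : Γ.bdry K ∪ W ⊆ S' := Finset.union_subset (fun v hv =>
    hSS' (Finset.mem_union_left _ (Finset.mem_union_left _ hv))) Finset.inter_subset_right
  have hYcard : (Γ.bdry K ∪ W).card ≤ F₁ := (Finset.card_le_card hYS').trans hS'card
  have hWcard : W.card ≤ F := (Finset.card_le_card Finset.subset_union_right).trans
    (hYcard.trans hF₁)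
  have hUK : ∀ x ∈ U, Γ.compIn U x ⊂ K := fun x hx =>
    ⟨(compIn_subset hx).trans Finset.sdiff_subset, fun h =>
      (Finset.mem_sdiff.1 (compIn_subset hx (h hx₀))).2 hx₀W⟩
  have hUbd : ∀ x ∈ U, (Γ.bdry (Γ.compIn U x)).card ≤ θ := fun x hx => by
    refine hS' (Γ.compIn U x) _ ⟨x, self_mem_compIn _ _⟩ (reachIn_compIn hx) ?_
      ((bdry_compIn_subset hx).trans hYS') subset_rfl
    rw [Finset.disjoint_left]
    intro z hz hzS'
    have := Finset.mem_sdiff.1 (compIn_subset hx hz)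
    exact this.2 (Finset.mem_inter.2 ⟨this.1, hzS'⟩)
  choose! col hcolL hcol using fun v (hv : v ∈ K) => hadm.exists_color c₀ hv
  let c₁ : V → ℤ := fun v => if v ∈ W then col v else c v
  have hc₁W : ∀ v ∈ W, c₁ v = col v := fun v hv => if_pos hv
  have hc₁ : ∀ v ∉ W, c₁ v = c v := fun v hv => if_neg hv
  let L₁ := Γ.reducedLists p T U c₁ L
  let P := U.filter fun v => v ∈ Γ.crowded p (Γ.compIn U v) ∧
      ¬ Γ.IsRichlyBounded p T (Γ.compIn U v)
  have hPcard : P.card ≤ F := by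
    refine (card_leaks_le hΓ K W).trans (le_trans ?_ hF)
    exact Nat.mul_le_mul (Nat.pow_le_pow_right (by norm_num) hYcard) (Nat.add_le_add_left hYcard _)
  -- the colours to be stopped next
  let R₁ : Finset V → Finset ℤ := fun C => if R = ∅ then (Γ.bdry C).image c₁ else R.erase c₀
  have hR₁ : ∀ x ∈ U, (R₁ (Γ.compIn U x)).card ≤ θ := by
    intro x hx
    simp only [R₁]
    split_ifs
    · exact Finset.card_image_le.trans (hUbd x hx)
    · exact (Finset.card_erase_le).trans hR
  have hrec : ∀ C : Finset V, ∃ c' : V → ℤ, ∀ x ∈ U, C = Γ.compIn U x →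
      (∀ v ∉ C, c' v = c₁ v) ∧ (∀ v ∈ C, c' v ∈ L₁ v) ∧
        (Γ.reached c' C ((Γ.bdry C).filter (c' · ∈ R₁ C))).card ≤ reachBound F (R₁ C).card ∧
        (Γ.reached c' C (Γ.bdry C)).card ≤ reachBound F (θ + 1 + (R₁ C).card) ∧
        ∀ x ∈ C, (Finset.univ.filter (Γ.MonoIn c' C x)).card ≤ reachBound F (θ + 1 + θ) := by
    intro C
    by_cases hC : ∃ x ∈ U, C = Γ.compIn U x
    · obtain ⟨x, hx, rfl⟩ := hC
      obtain ⟨c', h⟩ := ih _ (hUK x hx) c₁ L₁ (R₁ (Γ.compIn U x)) (hUbd x hx)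
        ((crowded_compIn_card_le hΓ hx).trans (Nat.mul_le_mul_right _
          (Nat.pow_le_pow_right (by norm_num) (hUbd x hx))))
        (hadm.reducedLists hcrW hWK hc₁ hx) (hR₁ x hx)
      exact ⟨c', fun _ _ _ => h⟩
    · exact ⟨c, fun x hx h => absurd ⟨x, hx, h⟩ hC⟩
  choose f hf using hrec
  let c' : V → ℤ := fun v => if v ∈ U then f (Γ.compIn U v) v else c₁ v
  have hc'U : ∀ v ∉ U, c' v = c₁ v := fun v hv => if_neg hv
  have hc'L₁ : ∀ v ∈ U, c' v ∈ L₁ v := fun v hv => by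
    simp only [c', if_pos hv]
    exact (hf _ v hv rfl).2.1 v (self_mem_compIn _ _)
  have hc'f : ∀ x ∈ U, ∀ z ∈ Γ.compIn U x ∪ Γ.bdry (Γ.compIn U x),
      c' z = f (Γ.compIn U x) z := by
    intro x hx z hz
    rcases Finset.mem_union.1 hz with hz | hz
    · simp only [c', if_pos (compIn_subset hx hz), compIn_eq hz]
    · rw [hc'U z (notMem_of_mem_bdry_compIn hx hz), (hf _ x hx rfl).1 z (mem_bdry.1 hz).1]
  have hc'K : ∀ v ∉ K, c' v = c v := fun v hv => by
    rw [hc'U v fun h => hv (Finset.mem_sdiff.1 h).1, hc₁ v fun h => hv (hWK h)]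
  have hP : ∀ v ∈ U, ∀ y ∈ Γ.bdry (Γ.compIn U v), Γ.Adj v y → c' v = c' y → v ∈ P := by
    intro v hv y hy hvy hcvy
    by_contra hvP
    have h1 := hc'L₁ v hv
    have h2 : ¬ (v ∈ Γ.crowded p (Γ.compIn U v) ∧ ¬ Γ.IsRichlyBounded p T (Γ.compIn U v)) :=
      fun h => hvP (Finset.mem_filter.2 ⟨hv, h⟩)
    simp only [L₁, SimpleGraph.reducedLists, if_neg h2] at h1
    refine (Finset.mem_sdiff.1 h1).2 (Finset.mem_image.2 ⟨y, mem_nbIn.2 ⟨hy, hvy⟩, ?_⟩)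
    rw [hcvy, hc'U y (notMem_of_mem_bdry_compIn hv hy)]
  have hPU : ∀ v ∈ P, v ∈ U := fun v hv => (Finset.mem_filter.1 hv).1
  have hbound : ∀ (Src : Finset V) (R' : Finset ℤ) (b : ℕ), Src ⊆ Γ.bdry K ∪ W →
      (∀ y ∈ Src, c' y ∈ R') → (∀ v ∈ P, (Γ.reached c' (Γ.compIn U v)
        ((Γ.bdry (Γ.compIn U v)).filter (c' · ∈ R'))).card ≤ reachBound F b) →
      (Γ.reached c' K Src).card ≤ reachBound F (b + 1) := by
    intro Src R' b hSrc hR' hb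
    refine (Finset.card_le_card (reached_subset hP hSrc hR')).trans
      ((Finset.card_union_le _ _).trans (Nat.add_le_add hWcard ?_))
    exact (Finset.card_biUnion_le_card_mul _ _ _ hb).trans (Nat.mul_le_mul_right _ hPcard)
  have hstay : ∀ y z, y ∈ Γ.bdry K → c' y = c₀ → Γ.MonoIn c' (K ∪ Γ.bdry K : Finset V) y z →
      z ∈ Γ.bdry K := by
    intro y z hy hyc hz
    induction hz with
    | refl => exact hy
    | @tail z z' hyz h ih =>
      obtain ⟨hadj, -, hz', hc⟩ := h
      rcases Finset.mem_union.1 (Finset.mem_coe.1 hz') with hz'K | hz'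
      · exfalso
        have hcz : c' z = c₀ := (MonoIn.color_eq hyz).symm.trans hyc
        have hzc : c' z = c z := hc'K z (mem_bdry.1 ih).1
        have hnb : z ∈ Γ.nbIn (Γ.bdry K) z' := mem_nbIn.2 ⟨ih, hadj.symm⟩
        by_cases hz'W : z' ∈ W
        · have h1 : c' z' = col z' := by
            rw [hc'U z' fun h => (Finset.mem_sdiff.1 h).2 hz'W, hc₁W z' hz'W]
          exact hcol z' hz'K z hnb (by rw [← h1, ← hc, hzc]) (by rw [← h1, ← hc, hcz])
        · have hz'U : z' ∈ U := Finset.mem_sdiff.2 ⟨hz'K, hz'W⟩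
          have h1 := reducedLists_subset p T U c₁ L z' (hc'L₁ z' hz'U)
          refine (hadm.few z' hz'K (not_le.1 fun h => hz'W (hcrW (mem_crowded.2 ⟨hz'K, h⟩)))).2
            z hnb ?_
          rwa [← hzc, hc]
      · exact hz'
  have hall : ∀ Src ⊆ Γ.bdry K ∪ W,
      (Γ.reached c' K Src).card ≤ reachBound F (θ + 1 + R.card) := by
    intro Src hSrc
    by_cases hR0 : R = ∅
    · have := hbound Src (Finset.univ.image c') θ hSrc (fun y _ => by simp) fun v hv => by
        rw [reached_congr (hc'f v (hPU v hv))]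
        refine (Finset.card_le_card (reached_mono fun y hy => ?_)).trans
          ((hf _ v (hPU v hv) rfl).2.2.1.trans (reachBound_mono F (hR₁ v (hPU v hv))))
        obtain ⟨hy, -⟩ := Finset.mem_filter.1 hy
        refine Finset.mem_filter.2 ⟨hy, ?_⟩
        simp only [R₁, if_pos hR0]
        rw [(hf _ v (hPU v hv) rfl).1 y (mem_bdry.1 hy).1]
        exact Finset.mem_image_of_mem _ hy
      simpa [hR0] using this
    · have hcard : R.card = (R.erase c₀).card + 1 :=
        (Finset.card_erase_add_one (hc₀ (Finset.nonempty_iff_ne_empty.2 hR0))).symm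
      rw [hcard]
      refine hbound Src (Finset.univ.image c') (θ + 1 + (R.erase c₀).card) hSrc
        (fun y _ => by simp) fun v hv => ?_
      rw [reached_congr (hc'f v (hPU v hv))]
      refine (Finset.card_le_card (reached_mono (Finset.filter_subset _ _))).trans ?_
      have := (hf _ v (hPU v hv) rfl).2.2.2.1
      simpa only [R₁, if_neg hR0] using this
  refine ⟨c', hc'K, fun v hv => ?_, ?_, hall _ Finset.subset_union_left, fun x hx => ?_⟩
  · by_cases hvW : v ∈ W
    · rw [hc'U v fun h => (Finset.mem_sdiff.1 h).2 hvW, hc₁W v hvW]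
      exact hcolL v hv
    · exact reducedLists_subset p T U c₁ L v (hc'L₁ v (Finset.mem_sdiff.2 ⟨hv, hvW⟩))
  · by_cases hR0 : R = ∅
    · simp [hR0, reached]
    · have hcard : R.card = (R.erase c₀).card + 1 :=
        (Finset.card_erase_add_one (hc₀ (Finset.nonempty_iff_ne_empty.2 hR0))).symm
      have hsub : Γ.reached c' K ((Γ.bdry K).filter (c' · ∈ R)) ⊆
          Γ.reached c' K ((Γ.bdry K).filter (c' · ∈ R.erase c₀)) := by
        intro z hz
        obtain ⟨hzK, y, hy, hyz⟩ := mem_reached.1 hz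
        obtain ⟨hy, hyR⟩ := Finset.mem_filter.1 hy
        refine mem_reached.2 ⟨hzK, y, Finset.mem_filter.2 ⟨hy, Finset.mem_erase.2 ⟨?_, hyR⟩⟩, hyz⟩
        exact fun h => (mem_bdry.1 (hstay y z hy h hyz)).1 hzK
      rw [hcard]
      refine (Finset.card_le_card hsub).trans (hbound _ (R.erase c₀) _
        ((Finset.filter_subset _ _).trans Finset.subset_union_left)
        (fun y hy => (Finset.mem_filter.1 hy).2) fun v hv => ?_)
      have h1 := (hf _ v (hPU v hv) rfl).2.2.1
      simp only [R₁, if_neg hR0] at h1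
      rw [reached_congr (hc'f v (hPU v hv))]
      refine le_trans (le_of_eq ?_) h1
      congr 1
      congr 1
      refine Finset.filter_congr fun y hy => ?_
      rw [hc'f v (hPU v hv) y (Finset.mem_union_right _ hy)]
  · by_cases hxW : ∃ w ∈ W, Γ.MonoIn c' K x w
    · obtain ⟨w, hw, hxw⟩ := hxW
      refine (Finset.card_le_card fun z hz => ?_).trans ((hall W Finset.subset_union_right).trans
        (reachBound_mono F (Nat.add_le_add_left hR _)))
      have hxz : Γ.MonoIn c' K x z := (Finset.mem_filter.1 hz).2
      refine mem_reached.2 ⟨?_, w, hw, MonoIn.mono (by simp) (fun _ _ => rfl)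
        (hxw.symm.trans hxz)⟩
      induction hxz with
      | refl => exact hx
      | tail _ h _ => exact h.2.2.1
    · push Not at hxW
      have hxU : x ∈ U := Finset.mem_sdiff.2 ⟨hx, fun h => hxW x h .refl⟩
      refine (Finset.card_le_card fun z hz => ?_).trans
        ((hf _ x hxU rfl).2.2.2.2 x (self_mem_compIn _ _))
      have hxz : Γ.MonoIn c' K x z := (Finset.mem_filter.1 hz).2
      refine Finset.mem_filter.2 ⟨Finset.mem_univ _, MonoIn.mono (S := (Γ.compIn U x : Set V))
        subset_rfl (fun y hy => hc'f x hxU y (Finset.mem_union_left _ hy)) ?_⟩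
      clear hz
      have : z ∈ Γ.compIn U x ∧ Γ.MonoIn c' (Γ.compIn U x) x z := by
        induction hxz with
        | refl => exact ⟨self_mem_compIn _ _, .refl⟩
        | @tail z z' hxz h ih =>
          have hz' : z' ∈ Γ.compIn U x := mem_compIn_of_adj hxU ih.1 h.1
            (Finset.mem_sdiff.2 ⟨h.2.2.1, fun h' => hxW z' h' (hxz.tail h)⟩)
          exact ⟨hz', ih.2.tail ⟨h.1, ih.1, hz', h.2.2.2⟩⟩
      exact this.2

end SimpleGraph

namespace Graph

/-! ### The lower bound -/

/-- The vertices of the complete `n`-ary tree with `s` levels, as sequences of choices of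
children. -/
abbrev TreeWord (n s : ℕ) : Type := {l : List (Fin n) // l.length < s}

/-- The closure of the complete `n`-ary tree with `s` levels: two nodes are adjacent if one is a
proper ancestor of the other. -/
def treeClosure (n s : ℕ) : SimpleGraph (TreeWord n s) where
  Adj a b := a ≠ b ∧ (a.1 <+: b.1 ∨ b.1 <+: a.1)
  symm := ⟨fun _ _ h => ⟨h.1.symm, h.2.symm⟩⟩

/-- The closure of the complete `n`-ary tree with `s` levels, as a multigraph. -/
abbrev closureGraph (n s : ℕ) : Graph (TreeWord n s) (Sym2 (TreeWord n s)) :=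
  ofSimpleGraph (treeClosure n s)

variable {n s : ℕ}

instance : Finite (TreeWord n s) := (List.finite_length_lt (Fin n) s).to_subtype

lemma closureGraph_adj_iff {x y : V(closureGraph n s)} :
    (closureGraph n s).toSimpleGraph.Adj x y ↔
      x ≠ y ∧ (x.1.1 <+: y.1.1 ∨ y.1.1 <+: x.1.1) := by
  rw [toSimpleGraph_adj, ofSimpleGraph_adj_iff, treeClosure]
  simp only [ne_eq, Subtype.ext_iff]
  tauto

lemma closureGraph_ext {x y : V(closureGraph n s)} (h : x.1.1 = y.1.1) : x = y :=
  Subtype.ext (Subtype.ext h)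

lemma prefix_eq_of_length {l l₁ l₂ : List (Fin n)} (h₁ : l₁ <+: l) (h₂ : l₂ <+: l)
    (h : l₁.length = l₂.length) : l₁ = l₂ :=
  (List.prefix_of_prefix_length_le h₁ h₂ h.le).eq_of_length h

/-- The complete `n`-ary tree with `s` levels. -/
def wordTree (n s : ℕ) : SimpleGraph (TreeWord n s) :=
  SimpleGraph.fromRel fun a b => a.1.dropLast = b.1

/-- The parent of a node; the root is its own parent. -/
def parent (a : TreeWord n s) : TreeWord n s :=
  ⟨a.1.dropLast, lt_of_le_of_lt (by simp) a.2⟩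

lemma parent_ne {a : TreeWord n s} (h : a.1 ≠ []) : parent a ≠ a := by
  intro h'
  have h1 := congrArg List.length (congrArg Subtype.val h')
  have h2 := List.length_pos_of_ne_nil h
  simp only [parent, List.length_dropLast] at h1
  omega

lemma wordTree_adj_parent {a : TreeWord n s} (h : a.1 ≠ []) : (wordTree n s).Adj a (parent a) :=
  (SimpleGraph.fromRel_adj _ _ _).2 ⟨(parent_ne h).symm, Or.inl rfl⟩

/-- The descendants of a node induce a connected subtree. -/
lemma wordTree_connected (x : TreeWord n s) :
    ((wordTree n s).induce {t | x.1 <+: t.1}).Connected := by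
  let r : {t : TreeWord n s | x.1 <+: t.1} := ⟨x, List.prefix_rfl⟩
  have key : ∀ k, ∀ t : {t : TreeWord n s | x.1 <+: t.1}, t.1.1.length = k →
      ((wordTree n s).induce {t | x.1 <+: t.1}).Reachable t r := by
    intro k
    induction k with
    | zero =>
      rintro ⟨t, ht⟩ hk
      have : t = x := by
        have h1 : t.1 = [] := List.eq_nil_of_length_eq_zero hk
        have h2 : x.1 = [] := List.prefix_nil.1 (h1 ▸ ht)
        exact Subtype.ext (h1.trans h2.symm)
      subst this
      exact .refl _
    | succ k ih =>
      rintro ⟨t, ht⟩ hk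
      by_cases htx : t = x
      · subst htx
        exact .refl _
      · have hne : t.1 ≠ [] := fun h => by simp [h] at hk
        have hpre : x.1 <+: (parent t).1 := by
          refine List.prefix_of_prefix_length_le ht (List.dropLast_prefix _) ?_
          have h1 := ht.length_le
          have h2 : x.1.length ≠ t.1.length := fun h => htx (Subtype.ext (ht.eq_of_length h)).symm
          simp only [parent, List.length_dropLast]
          omega
        refine SimpleGraph.Reachable.trans (SimpleGraph.Adj.reachable (v := ⟨parent t, hpre⟩) ?_)
          (ih ⟨parent t, hpre⟩ ?_)
        · exact wordTree_adj_parent hne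
        · simp only [parent, List.length_dropLast]
          simp only at hk
          omega
  have : Nonempty {t : TreeWord n s | x.1 <+: t.1} := ⟨r⟩
  exact ⟨fun a b => (key _ a rfl).trans (key _ b rfl).symm⟩

lemma wordTree_isTree (hs : 1 ≤ s) : (wordTree n s).IsTree := by
  classical
  let r : TreeWord n s := ⟨[], hs⟩
  have hconn : (wordTree n s).Connected := by
    have h := wordTree_connected r
    have : Nonempty (TreeWord n s) := ⟨r⟩
    refine ⟨fun a b => ?_⟩
    have hab := h.preconnected ⟨a, List.nil_prefix⟩ ⟨b, List.nil_prefix⟩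
    exact hab.map (SimpleGraph.Embedding.induce _).toHom
  refine SimpleGraph.isTree_iff_connected_and_card.2 ⟨hconn,
    le_antisymm ?_ hconn.card_vert_le_card_edgeSet_add_one⟩
  -- every edge joins a node other than the root to its parent
  have hsub : (wordTree n s).edgeSet ⊆ (fun a => s(a, parent a)) '' {r}ᶜ := by
    intro e
    induction e with
    | h a b =>
      intro hab
      rw [SimpleGraph.mem_edgeSet, wordTree, SimpleGraph.fromRel_adj] at hab
      have hne : ∀ a b : TreeWord n s, a ≠ b → a.1.dropLast = b.1 → a ∈ ({r}ᶜ : Set _) := by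
        rintro a b hab h rfl
        exact hab (Subtype.ext h)
      rcases hab with ⟨hab, h | h⟩
      · exact ⟨a, hne a b hab h, by simp only [show parent a = b from Subtype.ext h]⟩
      · refine ⟨b, hne b a hab.symm h, ?_⟩
        simp only
        rw [show parent b = a from Subtype.ext h, Sym2.eq_swap]
  have h1 := (Set.ncard_le_ncard hsub (Set.toFinite _)).trans (Set.ncard_image_le (Set.toFinite _))
  have h2 := Set.ncard_add_ncard_compl ({r} : Set (TreeWord n s))
  rw [Set.ncard_singleton] at h2
  rw [Nat.card_coe_set_eq]
  omega

lemma closureGraph_treewidth_le (hs : 1 ≤ s) : (closureGraph n s).treewidth ≤ (s - 1 : ℕ) := by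
  let D : (closureGraph n s).TreeDecomposition :=
    { node := TreeWord n s
      finite_node := inferInstance
      tree := wordTree n s
      isTree := wordTree_isTree hs
      bag := fun t => {x | x.1.1 <+: t.1}
      connected := fun x => wordTree_connected x.1
      edge := fun x y h => by
        rw [ofSimpleGraph_adj_iff] at h
        rcases h.2 with h | h
        · exact ⟨y.1, h, List.prefix_rfl⟩
        · exact ⟨x.1, List.prefix_rfl, h⟩ }
  refine (iInf_le _ D).trans (iSup_le fun t => ?_)
  rw [tsub_le_iff_right]
  have h1 : (D.bag t).encard ≤ (Set.Iio s).encard := by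
    refine Set.encard_le_encard_of_injOn (f := fun x => x.1.1.length) (fun x _ => x.1.2) ?_
    intro x hx y hy hxy
    exact closureGraph_ext (prefix_eq_of_length hx hy hxy)
  refine h1.trans ?_
  rw [← Finset.coe_Iio, Set.encard_coe_eq_coe_finsetCard, Nat.card_Iio]
  have : s = s - 1 + 1 := by omega
  exact_mod_cast this.le

/-- Every walk in the closure of a tree passes through a common ancestor of its ends. -/
lemma exists_common_prefix {x y : V(closureGraph n s)}
    (q : (closureGraph n s).toSimpleGraph.Walk x y) :
    ∃ z ∈ q.support, z.1.1 <+: x.1.1 ∧ z.1.1 <+: y.1.1 := by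
  induction q with
  | nil => exact ⟨_, by simp, List.prefix_rfl, List.prefix_rfl⟩
  | @cons x x' y h q ih =>
    obtain ⟨z, hz, hzx', hzy⟩ := ih
    have hz' : z ∈ (SimpleGraph.Walk.cons h q).support := by simp [hz]
    rcases (closureGraph_adj_iff.1 h).2 with h1 | h1
    · rcases List.prefix_or_prefix_of_prefix hzx' h1 with h2 | h2
      · exact ⟨z, hz', h2, hzy⟩
      · exact ⟨x, by simp, List.prefix_rfl, h2.trans hzy⟩
    · exact ⟨z, hz', hzx'.trans h1, hzy⟩

/-- Two branch vertices of a subdivision of the complete graph on `s + 1` vertices are joined by `s`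
paths that share no inner vertices, so in the closure of a tree with `s` levels one of them is an
ancestor of the other. -/
lemma branch_prefix (S : SubdivisionIn (SimpleGraph.completeGraph (Fin (s + 1)))
    (closureGraph n s)) (a b : Fin (s + 1)) :
    (S.branch a).1.1 <+: (S.branch b).1.1 ∨ (S.branch b).1.1 <+: (S.branch a).1.1 := by
  classical
  by_contra hab
  rw [not_or] at hab
  have hne : a ≠ b := fun h => hab.1 (h ▸ List.prefix_rfl)
  have hz : ∀ c, c ≠ a → ∃ z : V(closureGraph n s), z.1.1 <+: (S.branch a).1.1 ∧
      z.1.1 <+: (S.branch b).1.1 ∧ ∃ (d e : Fin (s + 1))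
        (h : (SimpleGraph.completeGraph (Fin (s + 1))).Adj d e), z ∈ (S.path d e h).support ∧
          ((d = a ∧ e = c) ∨ (d = c ∧ e = b)) := by
    intro c hca
    by_cases hcb : c = b
    · subst hcb
      obtain ⟨z, hz, h1, h2⟩ := exists_common_prefix (S.path a c hne)
      exact ⟨z, h1, h2, a, c, hne, hz, Or.inl ⟨rfl, rfl⟩⟩
    · obtain ⟨z, hz, h1, h2⟩ := exists_common_prefix
        ((S.path a c (Ne.symm hca)).append (S.path c b hcb))
      rcases (SimpleGraph.Walk.mem_support_append_iff _ _).1 hz with hz | hz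
      · exact ⟨z, h1, h2, a, c, _, hz, Or.inl ⟨rfl, rfl⟩⟩
      · exact ⟨z, h1, h2, c, b, _, hz, Or.inr ⟨rfl, rfl⟩⟩
  have : Nonempty V(closureGraph n s) := ⟨S.branch a⟩
  choose! z hza hzb hpath using hz
  have hzne : ∀ c, c ≠ a → z c ≠ S.branch a ∧ z c ≠ S.branch b := fun c hc =>
    ⟨fun h => hab.1 (h ▸ hzb c hc), fun h => hab.2 (h ▸ hza c hc)⟩
  have hlen : ∀ c, c ≠ a → (z c).1.1.length < s - 1 := by
    intro c hc
    have h1 := (hza c hc).length_le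
    have h2 : (z c).1.1.length ≠ (S.branch a).1.1.length := fun h =>
      (hzne c hc).1 (closureGraph_ext ((hza c hc).eq_of_length h))
    have h3 := (S.branch a).1.2
    omega
  obtain ⟨c, hc, c', hc', hcc', heq⟩ := Finset.exists_ne_map_eq_of_card_lt_of_maps_to
    (s := Finset.univ.erase a) (t := Finset.range (s - 1)) (f := fun c => (z c).1.1.length)
    (by
      rw [Finset.card_range, Finset.card_erase_of_mem (Finset.mem_univ _), Finset.card_univ,
        Fintype.card_fin]
      have := (S.branch a).1.2
      omega)
    (fun c hc => Finset.mem_coe.2 (Finset.mem_range.2 (hlen c (Finset.ne_of_mem_erase hc))))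
  have hca := Finset.ne_of_mem_erase hc
  have hca' := Finset.ne_of_mem_erase hc'
  have hzz : z c = z c' := closureGraph_ext (prefix_eq_of_length (hza c hca) (hza c' hca') heq)
  obtain ⟨d, e, hde, hz, h1⟩ := hpath c hca
  obtain ⟨d', e', hde', hz', h2⟩ := hpath c' hca'
  rw [← hzz] at hz'
  have hedge : s(d, e) ≠ s(d', e') := by
    have hde1 : d ≠ e := hde
    have hde2 : d' ≠ e' := hde'
    rw [Ne, Sym2.eq_iff]
    grind
  obtain ⟨f, hf⟩ := S.disjoint d e hde d' e' hde' hedge (z c) hz hz'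
  have h3 := S.branch_mem d e hde f (hf ▸ hz)
  have h4 := S.branch_mem d' e' hde' f (hf ▸ hz')
  have hfa : f ≠ a := fun h => (hzne c hca).1 (h ▸ hf)
  have hfb : f ≠ b := fun h => (hzne c hca).2 (h ▸ hf)
  grind

lemma closureGraph_not_containsSubdivision :
    ¬ (closureGraph n s).ContainsSubdivision (SimpleGraph.completeGraph (Fin (s + 1))) := by
  rintro ⟨S⟩
  obtain ⟨a, -, b, -, hab, heq⟩ := Finset.exists_ne_map_eq_of_card_lt_of_maps_to
    (s := (Finset.univ : Finset (Fin (s + 1)))) (t := Finset.range s)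
    (f := fun c => (S.branch c).1.1.length) (by simp)
    (fun c _ => Finset.mem_coe.2 (Finset.mem_range.2 (S.branch c).1.2))
  refine hab (S.branch_injective (closureGraph_ext ?_))
  rcases branch_prefix S a b with h | h
  · exact h.eq_of_length heq
  · exact (h.eq_of_length heq.symm).symm

/-- If a colour appears below each of the `n` children of a node of that colour, then the component
of the node is large; otherwise some child has a colour fewer below it. -/
lemma exists_large_component {C : Type*} (c : V(closureGraph n s) → C) :
    ∀ (k : ℕ) (x : V(closureGraph n s)) (R : Finset C), x.1.1.length + k = s → R.card < k →
      (∀ y : V(closureGraph n s), x.1.1 <+: y.1.1 → c y ∈ R) →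
        ∃ K : (closureGraph n s).MonochromaticComponent c, (n : ℕ∞) ≤ K.size := by
  classical
  intro k
  induction k with
  | zero => exact fun x R _ h _ => absurd h (Nat.not_lt_zero _)
  | succ k ih =>
    intro x R hk hR hxR
    have hxc := hxR x List.prefix_rfl
    have hk0 : 0 < k := lt_of_lt_of_le (Finset.card_pos.2 ⟨_, hxc⟩) (Nat.lt_succ_iff.1 hR)
    let child : Fin n → V(closureGraph n s) := fun j =>
      ⟨⟨x.1.1 ++ [j], by rw [List.length_append, List.length_singleton]; omega⟩, Set.mem_univ _⟩
    have hchild : ∀ j, x.1.1 <+: (child j).1.1 := fun j => List.prefix_append _ _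
    by_cases h : ∃ j, ∀ y : V(closureGraph n s), (child j).1.1 <+: y.1.1 → c y ≠ c x
    · obtain ⟨j, hj⟩ := h
      refine ih (child j) (R.erase (c x)) ?_ ?_ fun y hy =>
        Finset.mem_erase.2 ⟨hj y hy, hxR y ((hchild j).trans hy)⟩
      · simp only [child, List.length_append, List.length_singleton]
        omega
      · rw [Finset.card_erase_of_mem hxc]
        omega
    · push Not at h
      choose y hy hyc using h
      refine ⟨⟨c x, ((closureGraph n s).toSimpleGraph.induce
        {z | c z = c x}).connectedComponentMk ⟨x, rfl⟩⟩, ?_⟩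
      have hinj : Function.Injective fun j => (⟨y j, hyc j⟩ : {z | c z = c x}) := by
        intro i j hij
        have hij' : y i = y j := congrArg Subtype.val hij
        have h1 := prefix_eq_of_length (hy i) (hij' ▸ hy j) (by simp [child])
        simpa [child] using h1
      have h1 : (n : ℕ∞) = (Set.range fun j => (⟨y j, hyc j⟩ : {z | c z = c x})).encard := by
        rw [← Set.image_univ, hinj.encard_image, Set.encard_univ]
        simp
      rw [h1]
      refine Set.encard_le_encard ?_
      rintro _ ⟨j, rfl⟩
      rw [SimpleGraph.ConnectedComponent.mem_supp_iff, SimpleGraph.ConnectedComponent.eq]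
      refine SimpleGraph.Adj.reachable (SimpleGraph.induce_adj.2 ?_)
      refine closureGraph_adj_iff.2 ⟨fun h => ?_, Or.inr ((hchild j).trans (hy j))⟩
      have h2 := (hy j).length_le
      have h3 : (y j).1.1.length = x.1.1.length :=
        congrArg (fun z : V(closureGraph n s) => z.1.1.length) h
      simp only [child, List.length_append, List.length_singleton] at h2
      omega

end Graph

namespace Graph

/-! ### The two parts of the theorem -/

variable {α : Type u} {β : Type v}

lemma hasClustering_of_monoIn {G : Graph α β} [Fintype V(G)] {c : V(G) → ℤ} {η : ℕ}
    (h : ∀ x, ∃ M : Finset V(G), M.card ≤ η ∧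
      ∀ y, G.toSimpleGraph.MonoIn c Set.univ x y → y ∈ M) : G.HasClustering c η := by
  rintro ⟨i, K⟩
  induction K using SimpleGraph.ConnectedComponent.ind with
  | h x =>
    obtain ⟨M, hM, hxM⟩ := h x
    have hsub : Subtype.val '' ((G.toSimpleGraph.induce {x | c x = i}).connectedComponentMk
        x).supp ⊆ (M : Set V(G)) := by
      rintro _ ⟨y, hy, rfl⟩
      rw [SimpleGraph.ConnectedComponent.mem_supp_iff, SimpleGraph.ConnectedComponent.eq] at hy
      obtain ⟨w⟩ := hy.symm
      refine hxM y ?_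
      clear hxM hM
      induction w with
      | nil => exact .refl
      | @cons a b d hab w ih =>
        refine .head ⟨hab, trivial, trivial, ?_⟩ (ih ?_)
        · exact a.2.trans b.2.symm
        · exact (w.reachable.symm)
    have h1 := Set.encard_le_encard hsub
    rw [Subtype.val_injective.encard_image, Set.encard_coe_eq_coe_finsetCard] at h1
    exact h1.trans (by exact_mod_cast hM)

lemma separatesCommonNb {G : Graph α β} [Fintype V(G)] {p : ℕ}
    (h : ¬ G.ContainsAlmostSubdivision (SimpleGraph.completeGraph (Fin (p + 2)))) :
    G.toSimpleGraph.SeparatesCommonNb p (p * p + 2) := by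
  intro A hA hT x hx y hy hxy
  by_contra hne
  exact h (containsAlmostSubdivision_of_common hA hT
    (fun b hb => SimpleGraph.mem_commonNb.1 hb) hx hy hne hxy)

/-- The list-colouring argument applied to the set of all vertices, whose boundary is empty. The case
`p = 0` is separate, since lists of one colour leave no choice. -/
theorem exists_choosable (p w : ℕ) : ∃ η : ℕ, ∀ (α : Type u) (β : Type v) (G : Graph α β),
    V(G).Finite → G.treewidth ≤ w →
    ¬ G.ContainsAlmostSubdivision (SimpleGraph.completeGraph (Fin (p + 2))) →
    G.ChoosableWithClustering (p + 1) η := by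
  classical
  let T := p * p + 2
  let θ := 2 * (w + 1)
  let m := θ + 2 ^ θ * (T + 1) + 1
  let F₁ := (m + 1) * (m + 1) * (w + 1)
  let F := F₁ + 2 ^ F₁ * (T + F₁)
  refine ⟨max 1 (SimpleGraph.reachBound F (θ + 1 + θ)), fun α β G hfin htw hG L hL₀ hL => ?_⟩
  have : Fintype V(G) := hfin.fintype
  have hsep := separatesCommonNb hG
  rcases Nat.eq_zero_or_pos p with rfl | hp
  · -- a graph without a subdivided edge has no edges between distinct vertices
    choose c hc using hL₀
    refine ⟨c, hc, hasClustering_of_monoIn fun x => ⟨{x}, by simp, fun y hy => ?_⟩⟩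
    have hnoadj : ∀ x y, ¬ G.toSimpleGraph.Adj x y := by
      intro x y hxy
      have hmem : ∀ z, z ∈ G.toSimpleGraph.commonNb ∅ := fun z =>
        SimpleGraph.mem_commonNb.2 (by simp)
      refine hxy.ne (hsep ∅ rfl ?_ x (hmem x) y (hmem y) (.single ⟨hxy, by simp, by simp⟩))
      refine le_trans (Finset.card_pair hxy.ne).ge (Finset.card_le_card fun z _ => hmem z)
    induction hy with
    | refl => simp
    | tail _ h _ => exact (hnoadj _ _ h.1).elim
  · obtain ⟨N, _, _, D, hD⟩ := G.exists_rootedDecomposition htw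
    have hL' : ∀ x, ∃ l : Finset ℤ, (l : Set ℤ) ⊆ L x ∧ l.card = p + 1 := by
      intro x
      obtain ⟨t, ht, htc⟩ := Set.exists_subset_encard_eq (hL x)
      have htf : t.Finite := Set.finite_of_encard_eq_coe htc
      refine ⟨htf.toFinset, by simpa using ht, ?_⟩
      rw [htf.encard_eq_coe_toFinset_card] at htc
      exact_mod_cast htc
    choose l hl hlc using hL'
    have hb : G.toSimpleGraph.bdry Finset.univ = ∅ := by
      ext x
      simp [SimpleGraph.mem_bdry]
    have hnb : ∀ x, G.toSimpleGraph.nbIn ∅ x = ∅ := fun x => by simp [SimpleGraph.nbIn]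
    obtain ⟨c, -, hcl, -, -, hc⟩ := SimpleGraph.exists_extension (Γ := G.toSimpleGraph)
      (θ := θ) (F₁ := F₁) (F := F) hsep (fun S hS => by
        obtain ⟨S', h1, h2, h3⟩ := D.exists_closure hD S
        refine ⟨S', h1, h2.trans ?_, h3⟩
        have hS' : S.card + 1 ≤ m + 1 := Nat.succ_le_succ hS
        exact Nat.mul_le_mul_right _ (Nat.mul_le_mul hS' hS'))
      (Nat.le_add_right _ _) (Nat.le_add_left _ _) Finset.univ (fun _ => 0) l ∅
      (by simp [hb])
      (by
        have : G.toSimpleGraph.crowded p Finset.univ = ∅ := by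
          ext x
          simp only [SimpleGraph.mem_crowded, hb, hnb, Finset.card_empty]
          simp
          omega
        simp [this])
      ⟨fun x _ _ => by simp [hb, hnb, hlc], fun x _ h => by
        simp only [hb, hnb, Finset.card_empty] at h
        omega⟩
      (by simp)
    refine ⟨c, fun x => hl x (hcl x (Finset.mem_univ _)), hasClustering_of_monoIn fun x =>
      ⟨_, (hc x (Finset.mem_univ _)).trans (le_max_right _ _), fun y hy => ?_⟩⟩
    simpa using hy

end Graph

theorem theorem1 :
    (∀ s w : ℕ, 1 ≤ s → ∃ η : ℕ, ∀ (α : Type u) (β : Type v) (G : Graph α β),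
      V(G).Finite → G.treewidth ≤ w →
      ¬ G.ContainsAlmostSubdivision (SimpleGraph.completeGraph (Fin (s + 1))) →
      G.ChoosableWithClustering s η) ∧
    (∀ s η : ℕ, 1 ≤ s → ∃ (α β : Type) (G : Graph α β),
      V(G).Finite ∧ E(G).Finite ∧ G.treewidth ≤ (s - 1 : ℕ) ∧
      ¬ G.ContainsSubdivision (SimpleGraph.completeGraph (Fin (s + 1))) ∧
      ∀ c : V(G) → Fin (s - 1), ∃ K : G.MonochromaticComponent c, (η : ℕ∞) ≤ K.size) := by
  refine ⟨fun s w hs => ?_, fun s η hs => ?_⟩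
  · obtain ⟨p, rfl⟩ := Nat.exists_eq_add_of_le' hs
    exact Graph.exists_choosable p w
  · refine ⟨_, _, Graph.closureGraph η s, Set.toFinite _, Set.toFinite _,
      Graph.closureGraph_treewidth_le hs, Graph.closureGraph_not_containsSubdivision, fun c => ?_⟩
    refine Graph.exists_large_component c s ⟨⟨[], hs⟩, Set.mem_univ _⟩ Finset.univ
      (Nat.zero_add s) ?_ fun _ _ => Finset.mem_univ _
    rw [Finset.card_univ, Fintype.card_fin]
    omega
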